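/- Fix a universe of small sets. "Topos" means Grothendieck topos (a category equivalent to sheaves of small sets on a small site), and $\mathsf{Topoi}$ is the 2-category of topoi, geometric morphisms $f=(f^*\dashv f_*)$, $f^*$ left exact, and natural transformations between inverse images as 2-cells. $\mathsf{Psh}(\mathcal C)$ denotes the category of presheaves of small sets on a small category $\mathcal C$. "Left exact category" means small category with finite limits. Definitions. (a) $f$ is dominant if $f_*$ preserves the initial object; $\mathcal H_{\mathrm{dom}}$ is the class of dominant geometric morphisms. A right Kan extension of $x:\mathcal E\to\mathcal X$ along $f:\mathcal E\to\mathcal F$ in $\mathsf{Topoi}$ is a geometric morphism $r:\mathcal F\to\mathcal X$ with a universal 2-cell $\epsilon: r f\Rightarrow x$. It is pointwise if $r_*$, together with the mate $x_*\Rightarrow r_*f_*$ of $\epsilon$, is a left Kan extension of $x_*$ along $f_*$ among left exact functors; that is, every natural transformation $x_*\Rightarrow Gf_*$ with $G:\mathcal F\to\mathcal X$ left exact factors through this mate by a unique natural transformation $r_*\Rightarrow G$. $\mathcal X\in\mathsf{WRInj}_{\mathrm{pw}}(\mathcal H_{\mathrm{dom}})$ means that every $x:\mathcal E\to\mathcal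 X$ has a right Kan extension along every dominant $f:\mathcal E\to\mathcal F$, and these extensions are pointwise. (b) $\mathcal X$ is a coadjoint retract of $\mathcal Z$ if there are geometric morphisms $r:\mathcal Z\to\mathcal X$ and $s:\mathcal X\to\mathcal Z$ with $s\dashv r$ in $\mathsf{Topoi}$ and $rs\cong 1_{\mathcal X}$. (c) An essentially algebraic theory with falsum is a set $\mathbb T$ of sequents $\varphi\vdash_{\Gamma}\psi$ (the axioms) over a small many-sorted signature without relation symbols, in which only $\top,\wedge,=,\bot$ and existential quantifiers occur, each occurring quantification $\exists y\,\theta(y,x)$ being provably unique in $\mathbb T$, i.e. $\theta(y,x)\wedge\theta(y',x)\vdash y=y'$ is derivable from $\mathbb T$. A topos $\mathcal Z$ is a classifying topos $\mathsf{Set}[\mathbb T]$ of $\mathbb T$ if it carries a model $U$ of $\mathbb T$ such that for every topos $\mathcal F$ the functor $f\mapsto f^*U$ is an equivalence from the category of geometric morphisms $\mathcal F\to\mathcal Z$ to the category of models of $\mathbb T$ in $\mathcal F$ and homomorphisms. (d) A cosieve in a category $\mathcal C$ is a full subcategory $\mathcal D$ such that $d\in\mathcal D$ and $d\to c$ imply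 $c\in\mathcal D$. A topos is free if it is equivalent to $\mathsf{Psh}(\mathcal C)$ for a left exact category $\mathcal C$. A topos $\mathcal Z$ is a closed subtopos of $\mathcal E$ if there is a geometric morphism $i:\mathcal Z\to\mathcal E$ with $i_*$ fully faithful and a subterminal object $W$ of $\mathcal E$ such that the essential image of $i_*$ consists of those $A$ for which the projection $A\times W\to W$ is invertible. Theorem. (1) For every topos $\mathcal X$: $\mathcal X\in\mathsf{WRInj}_{\mathrm{pw}}(\mathcal H_{\mathrm{dom}})$ if and only if $\mathcal X$ is a coadjoint retract of a classifying topos $\mathsf{Set}[\mathbb T]$ of an essentially algebraic theory with falsum $\mathbb T$. (2) For every topos $\mathcal Z$ the following are equivalent: (i) $\mathcal Z$ is a classifying topos of an essentially algebraic theory with falsum; (ii) $\mathcal Z\simeq\mathsf{Psh}(\mathcal D)$ for a cosieve $\mathcal D$ in a left exact category $\mathcal C$; (iii) $\mathcal Z$ is a closed subtopos of a free topos. -/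

import Mathlib

open CategoryTheory CategoryTheory.Limits CategoryTheory.Bicategory

universe u

namespace KanInj

/-! ## The 2-category of Grothendieck topoi -/

/-- A (Grothendieck) topos: a category equivalent to the category of sheaves of `u`-small sets on
a `u`-small site. -/
structure Topos : Type (u + 2) where
  carrier : Type (u + 1)
  [cat : Category.{u} carrier]
  isGrothendieck : ∃ (C : Type u) (_ : SmallCategory C) (J : GrothendieckTopology C),
    Nonempty (carrier ≌ Sheaf J (Type u))

instance : CoeSort Topos.{u} (Type (u + 1)) := ⟨Topos.carrier⟩

attribute [instance] Topos.cat

instance (E : Topos.{u}) : HasLimits E.carrier := by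
  obtain ⟨C, _, J, ⟨e⟩⟩ := E.isGrothendieck
  exact Adjunction.has_limits_of_equivalence e.functor

instance (E : Topos.{u}) : HasColimits E.carrier := by
  obtain ⟨C, _, J, ⟨e⟩⟩ := E.isGrothendieck
  have : HasColimits (Sheaf J (Type u)) := ⟨fun _ _ => inferInstance⟩
  exact Adjunction.has_colimits_of_equivalence e.functor

instance (E : Topos.{u}) : HasFiniteLimits E.carrier := inferInstance

instance (E : Topos.{u}) : HasInitial E.carrier := inferInstance

instance (E : Topos.{u}) : HasImages E.carrier := by
  obtain ⟨C, _, J, ⟨e⟩⟩ := E.isGrothendieck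
  have : HasStrongEpiMonoFactorisations (Sheaf J (Type u)) :=
    ⟨fun f => ⟨{ Image.monoFactorisation f with
      e_strong_epi := inferInstanceAs (StrongEpi (factorThruImage f)) }⟩⟩
  have : HasStrongEpiMonoFactorisations E.carrier :=
    Functor.hasStrongEpiMonoFactorisations_imp_of_isEquivalence e.inverse
  infer_instance

/-- A geometric morphism `E ⟶ F`: an adjunction `f^* ⊣ f_*` with `f_* : E ⥤ F` and `f^*`
left exact. -/
structure GeomMor (E F : Topos.{u}) where
  inverse : F ⥤ E
  direct : E ⥤ F
  adj : inverse ⊣ direct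
  [lex : PreservesFiniteLimits inverse]

attribute [instance] GeomMor.lex

/-- A 2-cell of geometric morphisms: a natural transformation between the inverse images. -/
@[ext]
structure GeomMor.Hom₂ {E F : Topos.{u}} (f g : GeomMor E F) where
  nat : f.inverse ⟶ g.inverse

@[simps]
def GeomMor.id (E : Topos.{u}) : GeomMor E E where
  inverse := 𝟭 E
  direct := 𝟭 E
  adj := Adjunction.id

@[simps]
def GeomMor.comp {E F G : Topos.{u}} (f : GeomMor E F) (g : GeomMor F G) : GeomMor E G where
  inverse := g.inverse ⋙ f.inverse
  direct := f.direct ⋙ g.direct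
  adj := g.adj.comp f.adj
  lex := comp_preservesFiniteLimits _ _

@[simps]
instance : CategoryStruct Topos.{u} where
  Hom E F := GeomMor E F
  id E := GeomMor.id E
  comp f g := GeomMor.comp f g

instance GeomMor.category (E F : Topos.{u}) : Category (E ⟶ F) where
  Hom f g := GeomMor.Hom₂ f g
  id f := ⟨𝟙 (GeomMor.inverse f)⟩
  comp α β := ⟨GeomMor.Hom₂.nat α ≫ GeomMor.Hom₂.nat β⟩

/-- The underlying natural transformation of a 2-cell. -/
abbrev GeomMor.nat {E F : Topos.{u}} {f g : E ⟶ F} (α : f ⟶ g) :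
    GeomMor.inverse f ⟶ GeomMor.inverse g :=
  GeomMor.Hom₂.nat α

@[ext]
lemma GeomMor.hom_ext {E F : Topos.{u}} {f g : E ⟶ F} {α β : f ⟶ g}
    (h : ∀ X, (GeomMor.nat α).app X = (GeomMor.nat β).app X) : α = β :=
  GeomMor.Hom₂.ext (NatTrans.ext (funext h))

@[simp]
lemma GeomMor.id_nat {E F : Topos.{u}} (f : E ⟶ F) :
    GeomMor.nat (𝟙 f) = 𝟙 (GeomMor.inverse f) := rfl

@[simp]
lemma GeomMor.comp_nat {E F : Topos.{u}} {f g h : E ⟶ F} (α : f ⟶ g) (β : g ⟶ h) :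
    GeomMor.nat (α ≫ β) = GeomMor.nat α ≫ GeomMor.nat β := rfl

/-- An invertible 2-cell from an isomorphism of inverse images. -/
@[simps]
def GeomMor.isoMk {E F : Topos.{u}} {f g : E ⟶ F}
    (e : GeomMor.inverse f ≅ GeomMor.inverse g) : f ≅ g where
  hom := GeomMor.Hom₂.mk e.hom
  inv := GeomMor.Hom₂.mk e.inv
  hom_inv_id := GeomMor.Hom₂.ext e.hom_inv_id
  inv_hom_id := GeomMor.Hom₂.ext e.inv_hom_id

/-- The 2-category of topoi, geometric morphisms, and natural transformations between
inverse images. -/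
instance : Bicategory Topos.{u} where
  homCategory := GeomMor.category
  whiskerLeft f _ _ η :=
    GeomMor.Hom₂.mk (Functor.whiskerRight (GeomMor.nat η) (GeomMor.inverse f))
  whiskerRight η h :=
    GeomMor.Hom₂.mk (Functor.whiskerLeft (GeomMor.inverse h) (GeomMor.nat η))
  associator f g h := GeomMor.isoMk
    (Functor.associator (GeomMor.inverse h) (GeomMor.inverse g) (GeomMor.inverse f)).symm
  leftUnitor f := GeomMor.isoMk (Functor.rightUnitor (GeomMor.inverse f))
  rightUnitor f := GeomMor.isoMk (Functor.leftUnitor (GeomMor.inverse f))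
  id_whiskerLeft _ :=
    GeomMor.hom_ext fun _ => ((Category.id_comp _).trans (Category.comp_id _)).symm
  comp_whiskerLeft _ _ _ _ _ :=
    GeomMor.hom_ext fun _ => ((Category.id_comp _).trans (Category.comp_id _)).symm
  whiskerRight_id _ :=
    GeomMor.hom_ext fun _ => ((Category.id_comp _).trans (Category.comp_id _)).symm
  whiskerRight_comp _ _ _ :=
    GeomMor.hom_ext fun _ => ((Category.id_comp _).trans (Category.comp_id _)).symm
  whisker_assoc _ _ _ _ _ :=
    GeomMor.hom_ext fun _ => ((Category.id_comp _).trans (Category.comp_id _)).symm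
  whisker_exchange η _ := GeomMor.hom_ext fun _ => (GeomMor.nat η).naturality _
  pentagon f g h i := GeomMor.hom_ext fun X => by
    change 𝟙 _ ≫ 𝟙 _ ≫ (GeomMor.inverse f).map (𝟙 _) = 𝟙 _ ≫ 𝟙 _
    simp
  triangle f g := GeomMor.hom_ext fun X => by
    change 𝟙 _ ≫ (GeomMor.inverse f).map (𝟙 _) = 𝟙 _
    simp

/-! ## Weak right Kan injectivity -/

section Bicat

universe w v z

variable {B : Type z} [Bicategory.{w, v} B]

/-- `X` is weakly right Kan injective with respect to the class `H` of 1-cells: every 1-cell into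
`X` has a right Kan extension along every member of `H`. -/
def WRInj (H : ∀ ⦃a b : B⦄, (a ⟶ b) → Prop) (X : B) : Prop :=
  ∀ ⦃a b : B⦄ (f : a ⟶ b), H f → ∀ x : a ⟶ X, ∃ t : RightExtension f x, Nonempty t.IsKan

/-- `Y` is a coadjoint retract of `X`: there is a 1-cell `r : X ⟶ Y` with a left adjoint
`s : Y ⟶ X` such that `r ∘ s ≅ 1`. -/
def IsCoadjointRetract (Y X : B) : Prop :=
  ∃ (r : X ⟶ Y) (s : Y ⟶ X), Nonempty (s ⊣ r) ∧ Nonempty (s ≫ r ≅ 𝟙 Y)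

end Bicat

/-- The mate `x_* ⟶ f_* ⋙ r_*` of the 2-cell `r ∘ f ⟶ x` of a right extension. -/
def mate {E F X : Topos.{u}} {f : E ⟶ F} {x : E ⟶ X} (t : RightExtension f x) :
    GeomMor.direct x ⟶ GeomMor.direct f ⋙ GeomMor.direct t.extension :=
  conjugateEquiv (GeomMor.adj x) (GeomMor.adj (f ≫ t.extension)) (GeomMor.nat t.counit)

/-- A right Kan extension `r` of `x` along `f` in topoi is pointwise if the 2-functor `(-)_*` to
topoi, left exact functors and reversed natural transformations takes it to a right Kan extension
there, that is (because of the reversal of the 2-cells): `r_*`, with the mate of the counit, is a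
left Kan extension of `x_*` along `f_*` among left exact functors. -/
def IsPointwise {E F X : Topos.{u}} {f : E ⟶ F} {x : E ⟶ X} (t : RightExtension f x) : Prop :=
  ∀ (G : F ⥤ X) [PreservesFiniteLimits G] (β : GeomMor.direct x ⟶ GeomMor.direct f ⋙ G),
    ∃! α : GeomMor.direct t.extension ⟶ G,
      mate t ≫ Functor.whiskerLeft (GeomMor.direct f) α = β

/-- `X` is weakly right Kan injective with respect to `H`, and all its right Kan extensions along
members of `H` are pointwise. -/
def WRInjPw (H : ∀ ⦃E F : Topos.{u}⦄, (E ⟶ F) → Prop) (X : Topos.{u}) : Prop :=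
  WRInj H X ∧ ∀ ⦃E F : Topos.{u}⦄ (f : E ⟶ F), H f → ∀ (x : E ⟶ X) (t : RightExtension f x),
    Nonempty t.IsKan → IsPointwise t

/-- A geometric morphism is dominant if its direct image preserves the initial object. -/
def IsDominant ⦃E F : Topos.{u}⦄ (f : E ⟶ F) : Prop :=
  PreservesColimitsOfShape (Discrete PEmpty.{1}) (GeomMor.direct f)

/-! ## Algebraic signatures, terms, formulas -/

/-- An algebraic (many-sorted, no relation symbols) signature. -/
structure Signature : Type (u + 1) where
  Srt : Type u
  Op : Type u
  dom : Op → List Srt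
  cod : Op → Srt

variable {S : Signature.{u}}

/-- A context is a list of sorts; its variables are the positions in the list. -/
abbrev Ctx (S : Signature.{u}) : Type u := List S.Srt

/-- Terms in context. -/
inductive Term (S : Signature.{u}) (Γ : Ctx S) : S.Srt → Type u
  | var (i : Fin Γ.length) : Term S Γ (Γ.get i)
  | app (o : S.Op) (ts : ∀ i : Fin (S.dom o).length, Term S Γ ((S.dom o).get i)) :
      Term S Γ (S.cod o)

/-- A morphism of contexts: a term in context `Θ` for each variable of `Γ`. -/
abbrev Subst (Γ Θ : Ctx S) : Type u := ∀ i : Fin Γ.length, Term S Θ (Γ.get i)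

def Term.subst {Γ Θ : Ctx S} (σ : Subst Γ Θ) : ∀ {s : S.Srt}, Term S Γ s → Term S Θ s
  | _, .var i => σ i
  | _, .app o ts => .app o fun i => (ts i).subst σ

/-- Weakening by one new variable. -/
def wk (s : S.Srt) (Γ : Ctx S) : Subst Γ (s :: Γ) :=
  fun i => Term.var (Γ := s :: Γ) i.succ

/-- Extend a substitution by a term for the new variable. -/
def Subst.cons {Γ Θ : Ctx S} {s : S.Srt} (t : Term S Θ s) (σ : Subst Γ Θ) : Subst (s :: Γ) Θ :=
  fun i => Fin.cases (motive := fun i => Term S Θ ((s :: Γ).get i)) t σ i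

/-- The identity substitution. -/
def Subst.id (Γ : Ctx S) : Subst Γ Γ := fun i => Term.var i

/-- Lift a substitution under a binder. -/
def Subst.lift {Γ Θ : Ctx S} (s : S.Srt) (σ : Subst Γ Θ) : Subst (s :: Γ) (s :: Θ) :=
  Subst.cons (Term.var (Γ := s :: Θ) (0 : Fin (Θ.length + 1))) fun i => (σ i).subst (wk s Θ)

/-- Formulas in context built from equality, truth, falsum, conjunction and existential
quantification. In `ex φ`, the quantified variable is the first one of the context of `φ`. -/
inductive Formula (S : Signature.{u}) : Ctx S → Type u
  | top {Γ : Ctx S} : Formula S Γ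
  | bot {Γ : Ctx S} : Formula S Γ
  | eq {Γ : Ctx S} {s : S.Srt} (t t' : Term S Γ s) : Formula S Γ
  | and {Γ : Ctx S} (φ ψ : Formula S Γ) : Formula S Γ
  | ex {Γ : Ctx S} {s : S.Srt} (φ : Formula S (s :: Γ)) : Formula S Γ

def Formula.subst : ∀ {Γ Θ : Ctx S}, Subst Γ Θ → Formula S Γ → Formula S Θ
  | _, _, _, .top => .top
  | _, _, _, .bot => .bot
  | _, _, σ, .eq t t' => .eq (t.subst σ) (t'.subst σ)
  | _, _, σ, .and φ ψ => .and (φ.subst σ) (ψ.subst σ)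
  | _, _, σ, .ex φ => .ex (φ.subst (σ.lift _))

/-- A sequent `hyp ⊢ concl` in a context. -/
structure Sequent (S : Signature.{u}) : Type u where
  ctx : Ctx S
  hyp : Formula S ctx
  concl : Formula S ctx

/-- A theory is a set of sequents, its axioms. -/
abbrev Theory (S : Signature.{u}) : Type u := Set (Sequent S)

/-- Derivability of the sequent `φ ⊢ ψ` (in context `Γ`) from the axioms of `T`, by the rules of
geometric logic for the connectives at hand. Sorts may be empty, so contexts matter. -/
inductive Derivable (T : Theory S) : ∀ {Γ : Ctx S}, Formula S Γ → Formula S Γ → Prop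
  | ax (σ : Sequent S) : σ ∈ T → Derivable T σ.hyp σ.concl
  | refl {Γ : Ctx S} (φ : Formula S Γ) : Derivable T φ φ
  | cut {Γ : Ctx S} {φ ψ χ : Formula S Γ} : Derivable T φ ψ → Derivable T ψ χ → Derivable T φ χ
  | subst {Γ Θ : Ctx S} (σ : Subst Γ Θ) {φ ψ : Formula S Γ} :
      Derivable T φ ψ → Derivable T (φ.subst σ) (ψ.subst σ)
  | top {Γ : Ctx S} (φ : Formula S Γ) : Derivable T φ .top
  | bot {Γ : Ctx S} (φ : Formula S Γ) : Derivable T .bot φ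
  | andLeft {Γ : Ctx S} (φ ψ : Formula S Γ) : Derivable T (.and φ ψ) φ
  | andRight {Γ : Ctx S} (φ ψ : Formula S Γ) : Derivable T (.and φ ψ) ψ
  | andIntro {Γ : Ctx S} {φ ψ χ : Formula S Γ} :
      Derivable T φ ψ → Derivable T φ χ → Derivable T φ (.and ψ χ)
  | eqRefl {Γ : Ctx S} {s : S.Srt} (t : Term S Γ s) : Derivable T .top (.eq t t)
  | eqSubst {Γ : Ctx S} {s : S.Srt} (t t' : Term S Γ s) (φ : Formula S (s :: Γ)) :
      Derivable T (.and (.eq t t') (φ.subst (.cons t (.id Γ)))) (φ.subst (.cons t' (.id Γ)))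
  | exElim {Γ : Ctx S} {s : S.Srt} {φ : Formula S (s :: Γ)} {ψ : Formula S Γ} :
      Derivable T φ (ψ.subst (wk s Γ)) → Derivable T (.ex φ) ψ
  | exIntro {Γ : Ctx S} {s : S.Srt} {φ : Formula S (s :: Γ)} {ψ : Formula S Γ} :
      Derivable T (.ex φ) ψ → Derivable T φ (ψ.subst (wk s Γ))
  | frobenius {Γ : Ctx S} {s : S.Srt} (φ : Formula S Γ) (ψ : Formula S (s :: Γ)) :
      Derivable T (.and φ (.ex ψ)) (.ex (.and (φ.subst (wk s Γ)) ψ))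

/-- `T` proves that there is at most one `y` with `φ(y, x)`: the sequent
`φ(y, x) ∧ φ(y', x) ⊢ y = y'` in the context `y, y', x` is derivable from `T`. -/
def ProvablyUnique (T : Theory S) {Γ : Ctx S} {s : S.Srt} (φ : Formula S (s :: Γ)) : Prop :=
  let y : Term S (s :: s :: Γ) s := Term.var (Γ := s :: s :: Γ) (0 : Fin (Γ.length + 2))
  let y' : Term S (s :: s :: Γ) s := Term.var (Γ := s :: s :: Γ) (1 : Fin (Γ.length + 2))
  let x : Subst Γ (s :: s :: Γ) := fun i => Term.var (Γ := s :: s :: Γ) i.succ.succ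
  Derivable T (.and (φ.subst (.cons y x)) (φ.subst (.cons y' x))) (.eq y y')

/-- All existential quantifiers occurring in the formula are provably unique in `T`. -/
def UniqueEx (T : Theory S) : ∀ {Γ : Ctx S}, Formula S Γ → Prop
  | _, .top => True
  | _, .bot => True
  | _, .eq _ _ => True
  | _, .and φ ψ => UniqueEx T φ ∧ UniqueEx T ψ
  | _, .ex φ => UniqueEx T φ ∧ ProvablyUnique T φ

/-- An essentially algebraic theory with falsum: over an algebraic signature, the axioms involve
only `⊤`, `∧`, `=`, `⊥` and provably unique existential quantifiers. -/
def IsEssAlgWithFalsum (T : Theory S) : Prop :=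
  ∀ σ ∈ T, UniqueEx T σ.hyp ∧ UniqueEx T σ.concl

/-! ## Models and classifying topoi -/

/-- A structure for the signature `S` in a topos. -/
structure Str (S : Signature.{u}) (E : Topos.{u}) where
  sort : S.Srt → E
  op (o : S.Op) : (∏ᶜ fun i : Fin (S.dom o).length => sort ((S.dom o).get i)) ⟶ sort (S.cod o)

/-- A homomorphism of structures. -/
@[ext]
structure Str.Hom {E : Topos.{u}} (M N : Str S E) where
  map (s : S.Srt) : M.sort s ⟶ N.sort s
  comm (o : S.Op) : Limits.Pi.map (fun i => map ((S.dom o).get i)) ≫ N.op o = M.op o ≫ map (S.cod o) := by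
    cat_disch

@[simps]
instance {E : Topos.{u}} : Category (Str S E) where
  Hom := Str.Hom
  id M := { map := fun s => 𝟙 (M.sort s) }
  comp {M N K} α β :=
    { map := fun s => α.map s ≫ β.map s
      comm := fun o => by
        have : Limits.Pi.map (fun i => α.map ((S.dom o).get i) ≫ β.map ((S.dom o).get i)) =
            Limits.Pi.map (fun i => α.map ((S.dom o).get i)) ≫
              Limits.Pi.map (fun i => β.map ((S.dom o).get i)) := by
          ext; simp
        rw [this, Category.assoc, β.comm, ← Category.assoc, α.comm, Category.assoc] }

@[ext]
lemma Str.hom_ext {E : Topos.{u}} {M N : Str S E} {α β : M ⟶ N} (h : ∀ s, Str.Hom.map α s = Str.Hom.map β s) :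
    α = β :=
  Str.Hom.ext (funext h)

section Interpretation

variable {E : Topos.{u}} (M : Str S E)

/-- The interpretation of a context: the product of the interpretations of its sorts. -/
noncomputable abbrev Str.ctx (Γ : Ctx S) : E := ∏ᶜ fun i : Fin Γ.length => M.sort (Γ.get i)

noncomputable def Term.interp {Γ : Ctx S} : ∀ {s : S.Srt}, Term S Γ s → (M.ctx Γ ⟶ M.sort s)
  | _, .var i => Pi.π (fun i : Fin Γ.length => M.sort (Γ.get i)) i
  | _, .app o ts => Pi.lift (fun i => (ts i).interp) ≫ M.op o

/-- The projection that forgets the first variable. -/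
noncomputable def Str.proj (s : S.Srt) (Γ : Ctx S) : M.ctx (s :: Γ) ⟶ M.ctx Γ :=
  Pi.lift fun i => Pi.π (fun i : Fin (s :: Γ).length => M.sort ((s :: Γ).get i)) i.succ

/-- The interpretation of a formula in context as a subobject. Falsum is the image of the map from
the initial object, that is, the least subobject. -/
noncomputable def Formula.interp : ∀ {Γ : Ctx S}, Formula S Γ → Subobject (M.ctx Γ)
  | _, .top => ⊤
  | _, .bot => imageSubobject (initial.to _)
  | _, .eq t t' => equalizerSubobject (t.interp M) (t'.interp M)
  | _, .and φ ψ => φ.interp ⊓ ψ.interp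
  | _, .ex φ => imageSubobject (φ.interp.arrow ≫ M.proj _ _)

/-- `M` is a model of `T`. -/
def IsModel (T : Theory S) : Prop :=
  ∀ σ ∈ T, σ.hyp.interp M ≤ σ.concl.interp M

end Interpretation

/-- The structure `f^* U` obtained by applying the inverse image of `f`. -/
noncomputable def Str.pull {E F : Topos.{u}} (U : Str S E) (f : F ⟶ E) : Str S F where
  sort s := (GeomMor.inverse f).obj (U.sort s)
  op o := (PreservesProduct.iso (GeomMor.inverse f)
      (fun i : Fin (S.dom o).length => U.sort ((S.dom o).get i))).inv ≫
    (GeomMor.inverse f).map (U.op o)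

lemma map_app_comp_iso_inv {E F : Topos.{u}} {G G' : E ⥤ F} [PreservesFiniteLimits G]
    [PreservesFiniteLimits G'] (α : G ⟶ G') {n : ℕ} (X : Fin n → E) :
    Limits.Pi.map (fun i => α.app (X i)) ≫ (PreservesProduct.iso G' X).inv =
      (PreservesProduct.iso G X).inv ≫ α.app (∏ᶜ X) := by
  rw [Iso.comp_inv_eq, Category.assoc, Iso.eq_inv_comp]
  refine Limits.Pi.hom_ext _ _ fun i => ?_
  simp

/-- The functor `f ↦ f^* U` from geometric morphisms to structures. -/
noncomputable def Str.pullFunctor {E : Topos.{u}} (U : Str S E) (F : Topos.{u}) :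
    (F ⟶ E) ⥤ Str S F where
  obj f := U.pull f
  map {f g} α :=
    { map := fun s => (GeomMor.nat α).app (U.sort s)
      comm := fun o => by
        refine (Category.assoc _ _ _).symm.trans ?_
        refine (congrArg (· ≫ (GeomMor.inverse g).map (U.op o))
          (map_app_comp_iso_inv (GeomMor.nat α) _)).trans ?_
        refine (Category.assoc _ _ _).trans ?_
        refine Eq.trans ?_ (Category.assoc _ _ _).symm
        exact congrArg (_ ≫ ·) ((GeomMor.nat α).naturality _).symm }

/-- `Z` is a classifying topos of `T`: there is a structure `U` in `Z` such that for every topos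
`F`, the functor `f ↦ f^* U` is an equivalence from the category of geometric morphisms `F ⟶ Z` to
the category of models of `T` in `F`, i.e. it is fully faithful into structures and its essential
image consists of the models of `T`. -/
def IsClassifying (T : Theory S) (Z : Topos.{u}) : Prop :=
  ∃ U : Str S Z, ∀ F : Topos.{u}, (U.pullFunctor F).Full ∧ (U.pullFunctor F).Faithful ∧
    ∀ M : Str S F, IsModel M T ↔ (U.pullFunctor F).essImage M

/-! ## Cosieves, free topoi and closed subtopoi -/

/-- A cosieve (as a full subcategory): closed under morphisms going out of it. -/
def IsCosieve {C : Type u} [SmallCategory C] (D : ObjectProperty C) : Prop :=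
  ∀ ⦃d c : C⦄, D d → (d ⟶ c) → D c

/-- `Z` is the topos of presheaves on a cosieve in a small left exact category. -/
def IsPshOfCosieve (Z : Topos.{u}) : Prop :=
  ∃ (C : Type u) (_ : SmallCategory C) (_ : HasFiniteLimits C) (D : ObjectProperty C),
    IsCosieve D ∧ Nonempty (Z ≌ (D.FullSubcategoryᵒᵖ ⥤ Type u))

/-- A topos is free if it is equivalent to presheaves on a small left exact category. -/
def IsFree (E : Topos.{u}) : Prop :=
  ∃ (C : Type u) (_ : SmallCategory C) (_ : HasFiniteLimits C), Nonempty (E ≌ (Cᵒᵖ ⥤ Type u))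

/-- `i : Z ⟶ E` is a closed embedding: `i_*` is fully faithful, and for some subterminal object `W`
of `E` its essential image consists of the objects `A` for which the projection `A × W ⟶ W` is
invertible (the sheaves for the closed local operator of `W`). -/
def IsClosedEmbedding {Z E : Topos.{u}} (i : Z ⟶ E) : Prop :=
  (GeomMor.direct i).Full ∧ (GeomMor.direct i).Faithful ∧
    ∃ W : E, Mono (terminal.from W) ∧
      ∀ A : E, (GeomMor.direct i).essImage A ↔ IsIso (prod.snd : A ⨯ W ⟶ W)

/-- `Z` is (up to equivalence) a closed subtopos of a free topos. -/
def IsClosedSubtoposOfFree (Z : Topos.{u}) : Prop :=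
  ∃ (E : Topos.{u}) (i : Z ⟶ E), IsFree E ∧ IsClosedEmbedding i

end KanInj

/-! Dominance is what falsum needs. A direct image `f_*` is left exact; if it also preserves the
initial object, then, initial objects being strict, `X` is initial as soon as `f^* X` is. Equations
and uniquely witnessed existentials transpose along `f^* ⊣ f_*`, and falsum holds exactly over
initial objects, so `f_*` carries models to models (`isModel_push`).

Presheaves on a cosieve `D` of `C` classify left exact functors on `C` whose values off `D` are
initial. The nerve of such a functor is a singleton off `D`, so its Yoneda extension factors through
restriction to `D`, and the induced functor on presheaves on `D` is still left exact
(`lex_leftKanExtension`). These functors are the models of `catTheory D`. Conversely, let `U` be a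
generic model in `Z`, `C` the finite limit hull of its sorts and `D` the noninitial objects of `C`.
The nerve morphism `i` from `Z` to presheaves on `D` is dominant, so `i_* U` is a model and equals,
up to isomorphism, `p^* U` for some `p`. The comparison spreads from the sorts to `C` by finite
limits and makes `p^*` and `i^*` mutually inverse (`isPshOfCosieve_of_isClassifying`). As for closed
subtopoi, a subterminal presheaf `W` is a sieve of objects, and its closed sheaves are the
presheaves that are singletons on that sieve, i.e. those right Kan extended from the complementary
cosieve.

For a coadjoint retract `(r, s)` of presheaves on `D`, and `f` dominant, `f_* x^* s^*` is left exact
and preserves initial objects, so on `D` it agrees with the inverse image of some `T`. The extension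
is `r ∘ T`; density of `D` gives both its universal property and pointwiseness, in the common form
`Lifts`. Conversely, a weakly injective `X` embeds by a dominant `i` into presheaves on the
noninitial objects of a small left exact full subcategory containing generators. Pointwiseness makes
`p_*`, for `p` the extension of the identity along `i`, a left Kan extension of the identity along
`i_*`. By density the left exact functor `i^*` is one too. Hence `p_* ≅ i^*`, which gives `i ⊣ p`
and `p ∘ i ≅ 1` (`exists_isCoadjointRetract`). -/

namespace KanInj

open Opposite Presheaf

/-! ### Left exactness of Yoneda extensions (Diaconescu) -/

section YonedaExtension

variable {C : Type u} [SmallCategory C]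

/-- Cocontinuous functors on presheaves which agree on representables are isomorphic. -/
noncomputable def isoOfRepresentables {E : Type (u + 1)} [Category.{u} E] [HasColimits E]
    (L L' : (Cᵒᵖ ⥤ Type u) ⥤ E) [PreservesColimitsOfSize.{u, u} L]
    [PreservesColimitsOfSize.{u, u} L']
    (e : uliftYoneda.{u} ⋙ L ≅ uliftYoneda.{u} ⋙ L') : L ≅ L' :=
  uniqueExtensionAlongULiftYoneda.{u} L (Iso.refl (uliftYoneda.{u} ⋙ L)) ≪≫
    (uniqueExtensionAlongULiftYoneda.{u} L' e).symm

/-- The point of the presheaf topos on `C` given by a left exact functor to types. -/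
noncomputable def pointOfLex [HasFiniteLimits C] (N : C ⥤ Type u) [PreservesFiniteLimits N] :
    GrothendieckTopology.Point.{u} (⊥ : GrothendieckTopology C) where
  fiber := N
  isCofiltered := N.isCofiltered_elements
  initiallySmall := initiallySmall_of_essentiallySmall _
  jointly_surjective {U} R hR x := by
    obtain rfl : R = ⊤ := by simpa using hR
    exact ⟨U, 𝟙 _, by simp, x, by simp⟩

/-- The restriction of `L` to representables is a flat functor, hence a point of the presheaf topos.
The fiber functor of that point is left exact and cocontinuous and agrees with `L` on
representables, so it is `L`. -/
lemma lex_of_cocontinuous_type [HasFiniteLimits C] (L : (Cᵒᵖ ⥤ Type u) ⥤ Type u)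
    [PreservesColimitsOfSize.{u, u} L]
    [PreservesFiniteLimits (uliftYoneda.{u} ⋙ L : C ⥤ Type u)] : PreservesFiniteLimits L := by
  let Φ := pointOfLex (uliftYoneda.{u} ⋙ L : C ⥤ Type u)
  let e : uliftYoneda.{u} ⋙ L ≅ uliftYoneda.{u} ⋙ Φ.presheafFiber (A := Type u) :=
    Φ.shrinkYonedaCompPresheafFiberIso.symm ≪≫
      Functor.isoWhiskerRight uliftYonedaIsoShrinkYoneda.symm _
  exact preservesFiniteLimits_of_natIso (isoOfRepresentables _ _ e).symm

lemma lex_of_cocontinuous_presheaf [HasFiniteLimits C] {C₀ : Type u} [SmallCategory C₀]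
    (L : (Cᵒᵖ ⥤ Type u) ⥤ (C₀ᵒᵖ ⥤ Type u)) [PreservesColimitsOfSize.{u, u} L]
    [PreservesFiniteLimits (uliftYoneda.{u} ⋙ L : C ⥤ _)] : PreservesFiniteLimits L := by
  have h (d : C₀ᵒᵖ) : PreservesFiniteLimits (L ⋙ (evaluation C₀ᵒᵖ (Type u)).obj d) := by
    have : PreservesFiniteLimits
        (uliftYoneda.{u} ⋙ L ⋙ (evaluation _ (Type u)).obj d : C ⥤ Type u) :=
      inferInstanceAs (PreservesFiniteLimits
        ((uliftYoneda.{u} ⋙ L) ⋙ (evaluation C₀ᵒᵖ (Type u)).obj d))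
    exact lex_of_cocontinuous_type _
  exact ⟨fun J _ _ => preservesLimitsOfShape_of_evaluation L J fun d => (h d).preservesFiniteLimits J⟩

/-- Forgetting to presheaves keeps the restriction left exact, so the presheaf case applies to its
Yoneda extension `L'`. Sheafifying `L'` gives a left exact cocontinuous functor that agrees with `L`
on representables. -/
lemma lex_of_cocontinuous_sheaf [HasFiniteLimits C] {C₀ : Type u} [SmallCategory C₀]
    {J : GrothendieckTopology C₀} (L : (Cᵒᵖ ⥤ Type u) ⥤ Sheaf J (Type u))
    [PreservesColimitsOfSize.{u, u} L]
    [PreservesFiniteLimits (uliftYoneda.{u} ⋙ L : C ⥤ _)] : PreservesFiniteLimits L := by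
  let M' : C ⥤ (C₀ᵒᵖ ⥤ Type u) := (uliftYoneda.{u} ⋙ L) ⋙ sheafToPresheaf J _
  let L' := uliftYoneda.{u}.leftKanExtension M'
  let e : uliftYoneda.{u} ⋙ L' ≅ M' := isExtensionAlongULiftYoneda.{u} M'
  have : PreservesFiniteLimits (uliftYoneda.{u} ⋙ L') := preservesFiniteLimits_of_natIso e.symm
  have : PreservesColimitsOfSize.{u, u} L' := preservesColimitsOfSize_leftKanExtension.{u} M'
  have : PreservesFiniteLimits L' := lex_of_cocontinuous_presheaf L'
  have : PreservesColimitsOfSize.{u, u} (presheafToSheaf J (Type u)) :=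
    (sheafificationAdjunction J (Type u)).leftAdjoint_preservesColimits
  have : HasColimits (Sheaf J (Type u)) := ⟨fun _ _ => inferInstance⟩
  refine preservesFiniteLimits_of_natIso
    (isoOfRepresentables (L' ⋙ presheafToSheaf J (Type u)) L ?_)
  exact (Functor.associator _ _ _).symm ≪≫ Functor.isoWhiskerRight e _ ≪≫
    Functor.associator _ _ _ ≪≫ Functor.isoWhiskerLeft (uliftYoneda.{u} ⋙ L)
      (asIso (sheafificationAdjunction J (Type u)).counit) ≪≫ Functor.rightUnitor _

/-- Diaconescu: a cocontinuous functor from presheaves on a left exact category to a topos is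
left exact as soon as its restriction to representables is. -/
lemma lex_of_cocontinuous [HasFiniteLimits C] {E : Topos.{u}} (L : (Cᵒᵖ ⥤ Type u) ⥤ E)
    [PreservesColimitsOfSize.{u, u} L]
    [PreservesFiniteLimits (uliftYoneda.{u} ⋙ L : C ⥤ _)] : PreservesFiniteLimits L := by
  obtain ⟨C₀, _, J, ⟨e⟩⟩ := E.isGrothendieck
  have : PreservesFiniteLimits (uliftYoneda.{u} ⋙ L ⋙ e.functor) :=
    inferInstanceAs (PreservesFiniteLimits ((uliftYoneda.{u} ⋙ L) ⋙ e.functor))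
  have : PreservesFiniteLimits (L ⋙ e.functor) := lex_of_cocontinuous_sheaf _
  exact preservesFiniteLimits_of_natIso (Functor.associator L e.functor e.inverse ≪≫
    Functor.isoWhiskerLeft L e.unitIso.symm ≪≫ L.rightUnitor)

end YonedaExtension

/-! ### Presheaves on a cosieve -/

section Cosieve

variable {C : Type u} [SmallCategory C] (D : ObjectProperty C)

/-- Restriction of presheaves to a full subcategory. -/
abbrev restr : (Cᵒᵖ ⥤ Type u) ⥤ (D.FullSubcategoryᵒᵖ ⥤ Type u) :=
  (Functor.whiskeringLeft _ _ _).obj D.ι.op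

/-- Right Kan extension of presheaves from a full subcategory. -/
noncomputable abbrev extn : (D.FullSubcategoryᵒᵖ ⥤ Type u) ⥤ (Cᵒᵖ ⥤ Type u) := D.ι.op.ran

noncomputable abbrev restrAdj : restr D ⊣ extn D := D.ι.op.ranAdjunction (Type u)

instance : PreservesLimits (extn D) := (restrAdj D).rightAdjoint_preservesLimits

instance : (extn D).Full := (restrAdj D).fullyFaithfulROfIsIsoCounit.full

instance : (extn D).Faithful := (restrAdj D).fullyFaithfulROfIsIsoCounit.faithful

/-- Representables of the full subcategory are restrictions of representables. -/
def yonedaRestrIso : D.ι ⋙ uliftYoneda.{u} ⋙ restr D ≅ uliftYoneda.{u} :=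
  NatIso.ofComponents fun d => NatIso.ofComponents fun d' =>
    (Equiv.ulift.trans (D.fullyFaithfulι.homEquiv.symm.trans Equiv.ulift.symm)).toIso

variable {D} (hD : IsCosieve D)
include hD

/-- An arrow from an object of `D` to `c` would put `c` in `D`, so the restricted representable is
empty. -/
lemma isInitial_restr_yoneda {c : C} (hc : ¬ D c) :
    Nonempty (IsInitial ((restr D).obj (uliftYoneda.{u}.obj c))) := by
  have h (d : D.FullSubcategoryᵒᵖ) : IsEmpty (((restr D).obj (uliftYoneda.{u}.obj c)).obj d) :=
    ⟨fun f => hc (hD d.unop.property f.down)⟩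
  refine ⟨IsInitial.ofUniqueHom (fun P => { app d := ↾fun x => ((h d).false x).elim, naturality := ?_ }) ?_⟩
  · intro d d' f
    ext x
    exact ((h d).false x).elim
  · intro P m
    ext d x
    exact ((h d).false x).elim

/-- By adjunction, elements of a right Kan extension at `c` off `D` are maps out of an initial
presheaf, so there is exactly one. Over `D` the unit is always invertible. -/
lemma isIso_unit_iff (P : Cᵒᵖ ⥤ Type u) :
    IsIso ((restrAdj D).unit.app P) ↔ ∀ c, ¬ D c → ∃! _ : P.obj (op c), True := by
  have key (Q : D.FullSubcategoryᵒᵖ ⥤ Type u) (c : C) (hc : ¬ D c) :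
      ∃! _ : ((extn D).obj Q).obj (op c), True := by
    obtain ⟨hi⟩ := isInitial_restr_yoneda hD hc
    refine ⟨uliftYonedaEquiv.{u} ((restrAdj D).homEquiv _ _ (hi.to Q)), trivial, fun y _ => ?_⟩
    rw [← uliftYonedaEquiv.{u}.symm_apply_eq, ← Equiv.symm_apply_eq]
    exact hi.hom_ext _ _
  constructor
  · intro h c hc
    obtain ⟨y, -, hy⟩ := key ((restr D).obj P) c hc
    let e := (asIso ((restrAdj D).unit.app P)).app (op c)
    refine ⟨e.inv y, trivial, fun x _ => ?_⟩
    apply e.toEquiv.injective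
    exact (hy _ trivial).trans (hy _ trivial).symm
  · intro h
    rw [NatTrans.isIso_iff_isIso_app]
    rintro ⟨c⟩
    by_cases hc : D c
    -- The counit is invertible, so the triangle identity makes the restriction of the unit to `D`
    -- invertible.
    · have h1 := (restrAdj D).left_triangle_components P
      have : IsIso ((restr D).map ((restrAdj D).unit.app P)) := by
        have : IsIso ((restr D).map ((restrAdj D).unit.app P) ≫
          (restrAdj D).counit.app ((restr D).obj P)) := by rw [h1]; exact IsIso.id _
        exact IsIso.of_isIso_comp_right _ ((restrAdj D).counit.app ((restr D).obj P))
      rw [NatTrans.isIso_iff_isIso_app] at this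
      exact this (op ⟨c, hc⟩)
    · rw [isIso_iff_bijective]
      obtain ⟨x, -, hx⟩ := h c hc
      obtain ⟨y, -, hy⟩ := key ((restr D).obj P) c hc
      exact ⟨fun a b _ => (hx a trivial).trans (hx b trivial).symm,
        fun b => ⟨x, (hy _ trivial).trans (hy b trivial).symm⟩⟩

lemma essImage_extn_iff (P : Cᵒᵖ ⥤ Type u) :
    (extn D).essImage P ↔ ∀ c, ¬ D c → ∃! _ : P.obj (op c), True := by
  rw [← isIso_unit_iff hD]
  exact (restrAdj D).isIso_unit_app_iff_mem_essImage.symm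

/-- The Yoneda extension of the restriction to a cosieve of a left exact functor which vanishes off
the cosieve is left exact. -/
lemma lex_leftKanExtension [HasFiniteLimits C] {E : Topos.{u}} (M : C ⥤ E)
    [PreservesFiniteLimits M] (hM : ∀ c, ¬ D c → Nonempty (IsInitial (M.obj c))) :
    PreservesFiniteLimits (uliftYoneda.{u}.leftKanExtension (D.ι ⋙ M)) := by
  let L := uliftYoneda.{u}.leftKanExtension M
  let L' := uliftYoneda.{u}.leftKanExtension (D.ι ⋙ M)
  let adj : L ⊣ restrictedULiftYoneda.{u} M :=
    uliftYonedaAdjunction.{u} _ (uliftYoneda.{u}.leftKanExtensionUnit M)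
  let adj' : L' ⊣ restrictedULiftYoneda.{u} (D.ι ⋙ M) :=
    uliftYonedaAdjunction.{u} _ (uliftYoneda.{u}.leftKanExtensionUnit (D.ι ⋙ M))
  have : PreservesFiniteLimits (uliftYoneda.{u} ⋙ L) :=
    preservesFiniteLimits_of_natIso (isExtensionAlongULiftYoneda.{u} M).symm
  have : PreservesFiniteLimits L := lex_of_cocontinuous L
  -- The nerve of `M` at `c` off `D` is the set of maps out of the initial object `M c`.
  have hu (A : E) : IsIso ((restrAdj D).unit.app ((restrictedULiftYoneda.{u} M).obj A)) := by
    rw [isIso_unit_iff hD]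
    intro c hc
    obtain ⟨hi⟩ := hM c hc
    exact ⟨ULift.up (hi.to A), trivial, fun y _ => ULift.ext _ _ (hi.hom_ext _ _)⟩
  have hu' : IsIso (Functor.whiskerLeft (restrictedULiftYoneda.{u} M) (restrAdj D).unit) := by
    rw [NatTrans.isIso_iff_isIso_app]
    exact hu
  let e : restrictedULiftYoneda.{u} M ≅ restrictedULiftYoneda.{u} (D.ι ⋙ M) ⋙ extn D :=
    (Functor.rightUnitor _).symm ≪≫
      @asIso _ _ _ _ (Functor.whiskerLeft (restrictedULiftYoneda.{u} M) (restrAdj D).unit) hu'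
  -- Passing to left adjoints in `e`; precomposing with `extn D`, which is continuous and a section
  -- of restriction, then exhibits `L'` as a composite of left exact functors.
  let e' : L ≅ restr D ⋙ L' :=
    Iso.symm ((conjugateIsoEquiv adj ((restrAdj D).comp adj')).symm e)
  have : PreservesFiniteLimits (extn D) := inferInstance
  exact preservesFiniteLimits_of_natIso (Functor.isoWhiskerLeft (extn D) e' ≪≫
    (Functor.associator _ _ _).symm ≪≫
      Functor.isoWhiskerRight (asIso (restrAdj D).counit) L' ≪≫ L'.leftUnitor)

end Cosieve

/-- The topos of presheaves on a small category. -/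
abbrev pshTopos (C : Type u) [SmallCategory C] : Topos.{u} where
  carrier := Cᵒᵖ ⥤ Type u
  isGrothendieck := ⟨C, inferInstance, ⊥, ⟨(sheafBotEquivalence (Type u)).symm⟩⟩

/-! ### Presheaves on a cosieve as a classifying object -/

section CosievePres

variable {C : Type u} [SmallCategory C] {D : ObjectProperty C}

/-- The geometric morphism to presheaves on a cosieve classified by a left exact functor vanishing
off the cosieve. -/
noncomputable def nerveMor (hD : IsCosieve D) [HasFiniteLimits C] {F : Topos.{u}} (M : C ⥤ F)
    [PreservesFiniteLimits M] (hM : ∀ c, ¬ D c → Nonempty (IsInitial (M.obj c))) :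
    F ⟶ pshTopos D.FullSubcategory :=
  GeomMor.mk (F := pshTopos D.FullSubcategory) (uliftYoneda.{u}.leftKanExtension (D.ι ⋙ M))
    (restrictedULiftYoneda.{u} (D.ι ⋙ M))
    (uliftYonedaAdjunction.{u} _ (uliftYoneda.{u}.leftKanExtensionUnit (D.ι ⋙ M)))
    (lex := lex_leftKanExtension hD M hM)

/-- A presentation of a topos as classifying left exact functors out of a small left exact
category which vanish off a class of objects. -/
structure CosievePres (Z : Topos.{u}) where
  C : Type u
  [cat : SmallCategory C]
  [lim : HasFiniteLimits C]
  D : ObjectProperty C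
  isCosieve : IsCosieve D
  incl : C ⥤ Z
  [lex : PreservesFiniteLimits incl]
  initial : ∀ c, ¬ D c → Nonempty (IsInitial (incl.obj c))
  [dense : (D.ι ⋙ incl).IsDense]
  lift : ∀ (F : Topos.{u}) (M : C ⥤ F) [PreservesFiniteLimits M],
    (∀ c, ¬ D c → Nonempty (IsInitial (M.obj c))) →
      ∃ g : F ⟶ Z, Nonempty ((D.ι ⋙ incl) ⋙ GeomMor.inverse g ≅ D.ι ⋙ M)

attribute [instance] CosievePres.cat CosievePres.lim CosievePres.lex CosievePres.dense

/-- The inclusion is the restricted Yoneda embedding transported to `Z`. On `D` it is the Yoneda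
embedding itself, whence density; lifts are the nerve morphisms `nerveMor`. -/
lemma nonempty_cosievePres {Z : Topos.{u}} (hZ : IsPshOfCosieve Z) :
    Nonempty (CosievePres Z) := by
  obtain ⟨C, _, _, D, hD, ⟨e⟩⟩ := hZ
  let j : D.ι ⋙ uliftYoneda.{u} ⋙ restr D ⋙ e.inverse ≅ uliftYoneda.{u} ⋙ e.inverse :=
    Functor.isoWhiskerRight (yonedaRestrIso D) e.inverse
  exact ⟨{
    C := C
    D := D
    isCosieve := hD
    incl := uliftYoneda.{u} ⋙ restr D ⋙ e.inverse
    lex := inferInstance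
    initial := fun c hc => by
      obtain ⟨hi⟩ := isInitial_restr_yoneda hD hc
      exact ⟨hi.isInitialObj e.inverse⟩
    dense := Functor.IsDense.of_iso j.symm
    lift := fun F M _ hM => by
      let g := nerveMor hD M hM
      refine ⟨GeomMor.mk (e.functor ⋙ GeomMor.inverse g) (GeomMor.direct g ⋙ e.inverse)
        (e.toAdjunction.comp (GeomMor.adj g)) (lex := ?_), ⟨?_⟩⟩
      · have : PreservesFiniteLimits (GeomMor.inverse g) := GeomMor.lex g
        exact comp_preservesFiniteLimits e.functor (GeomMor.inverse g)
      · exact Functor.isoWhiskerRight j (e.functor ⋙ GeomMor.inverse g) ≪≫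
          Functor.isoWhiskerLeft uliftYoneda.{u}
            (Functor.isoWhiskerRight e.counitIso (GeomMor.inverse g)) ≪≫
          Functor.isoWhiskerLeft uliftYoneda.{u} (Functor.leftUnitor _) ≪≫
          isExtensionAlongULiftYoneda.{u} (D.ι ⋙ M) }⟩

end CosievePres

/-! ### Closed subtopoi of free topoi -/

section Closed

/-- Invertibility of the projection says that `A` looks terminal from every object over `W`. In this
form it can be tested on representables and transported along equivalences. -/
lemma isIso_prod_snd_iff {E : Type*} [Category* E] [HasBinaryProducts E] (A W : E) :
    IsIso (prod.snd : A ⨯ W ⟶ W) ↔ ∀ X : E, Nonempty (X ⟶ W) → ∃! _ : X ⟶ A, True := by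
  constructor
  · rintro _ X ⟨w⟩
    refine ⟨w ≫ inv prod.snd ≫ prod.fst, trivial, fun a _ => ?_⟩
    have : prod.lift a w = w ≫ inv prod.snd :=
      (IsIso.eq_comp_inv _).2 (prod.lift_snd a w)
    rw [← Category.assoc, ← this, prod.lift_fst]
  · intro h
    obtain ⟨a, -, -⟩ := h W ⟨𝟙 W⟩
    refine ⟨prod.lift a (𝟙 W), ?_, prod.lift_snd _ _⟩
    obtain ⟨b, -, hb⟩ := h (A ⨯ W) ⟨prod.snd⟩
    apply Limits.prod.hom_ext
    · exact (hb _ trivial).trans (hb _ trivial).symm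
    · rw [Category.assoc, prod.lift_snd, Category.comp_id, Category.id_comp]

/-- Forwards, evaluate at representables. Backwards, the unique elements assemble into a
transformation whose naturality and uniqueness are both instances of uniqueness of elements. -/
lemma psh_forall_iff {C : Type u} [SmallCategory C] (P W : Cᵒᵖ ⥤ Type u) :
    (∀ X : Cᵒᵖ ⥤ Type u, Nonempty (X ⟶ W) → ∃! _ : X ⟶ P, True) ↔
      ∀ c, Nonempty (W.obj (op c)) → ∃! _ : P.obj (op c), True := by
  constructor
  · rintro h c ⟨w⟩
    obtain ⟨p, -, hp⟩ := h (uliftYoneda.{u}.obj c) ⟨uliftYonedaEquiv.{u}.symm w⟩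
    refine ⟨uliftYonedaEquiv.{u} p, trivial, fun y _ => ?_⟩
    rw [← uliftYonedaEquiv.{u}.symm_apply_eq]
    exact hp _ trivial
  · rintro h X ⟨w⟩
    have h' (c : Cᵒᵖ) (x : X.obj c) : ∃! _ : P.obj c, True := h c.unop ⟨w.app c x⟩
    refine ⟨{ app c := ↾fun x => (h' c x).choose, naturality := ?_ }, trivial, ?_⟩
    · intro c c' f
      ext x
      exact (h' c' (X.map f x)).unique trivial trivial
    · intro m _
      ext c x
      exact (h' c x).unique trivial trivial

lemma isClosedSubtoposOfFree_of_isPshOfCosieve {Z : Topos.{u}} (hZ : IsPshOfCosieve Z) :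
    IsClosedSubtoposOfFree Z := by
  obtain ⟨C, _, _, D, hD, ⟨e⟩⟩ := hZ
  -- The complement of a cosieve is a sieve, that is, a subterminal presheaf: inhabited exactly off
  -- `D`.
  let W : Cᵒᵖ ⥤ Type u :=
    { obj c := ULift (PLift (¬ D c.unop))
      map f := ↾fun x => ⟨⟨fun h => x.down.down (hD h f.unop)⟩⟩ }
  have hW (c : C) : Nonempty (W.obj (op c)) ↔ ¬ D c := ⟨fun ⟨x⟩ => x.down.down, fun h => ⟨⟨⟨h⟩⟩⟩⟩
  let i : Z ⟶ pshTopos C := GeomMor.mk (F := pshTopos C) (restr D ⋙ e.inverse)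
    (e.functor ⋙ extn D) ((restrAdj D).comp e.symm.toAdjunction)
    (lex := comp_preservesFiniteLimits _ _)
  refine ⟨pshTopos C, i, ⟨C, _, inferInstance, ⟨CategoryTheory.Equivalence.refl⟩⟩,
    inferInstanceAs (e.functor ⋙ extn D).Full, inferInstanceAs (e.functor ⋙ extn D).Faithful,
    W, ⟨fun f g _ => ?_⟩, fun A => ?_⟩
  · ext c x
    exact congrArg ULift.down (Subsingleton.elim (α := ULift (PLift (¬ D c.unop))) _ _)
  · have h1 : (GeomMor.direct i).essImage A ↔ (extn D).essImage A := by
      constructor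
      · rintro ⟨X, ⟨a⟩⟩
        exact ⟨e.functor.obj X, ⟨a⟩⟩
      · rintro ⟨X, ⟨a⟩⟩
        exact ⟨e.inverse.obj X, ⟨(extn D).mapIso (e.counitIso.app X) ≪≫ a⟩⟩
    rw [h1, essImage_extn_iff hD, isIso_prod_snd_iff, psh_forall_iff]
    simp only [hW]

/-- Fully faithful functors with the same essential image have equivalent sources. -/
lemma nonempty_equivalence_of_essImage_eq {A B E : Type*} [Category* A] [Category* B] [Category* E]
    (F : A ⥤ E) (G : B ⥤ E) [F.Full] [F.Faithful] [G.Full] [G.Faithful]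
    (h : F.essImage = G.essImage) : Nonempty (A ≌ B) := by
  have e1 : Nonempty (A ≌ F.EssImageSubcategory) := ⟨F.toEssImage.asEquivalence⟩
  have e2 : Nonempty (B ≌ G.EssImageSubcategory) := ⟨G.toEssImage.asEquivalence⟩
  unfold Functor.EssImageSubcategory at e1 e2
  rw [h] at e1
  exact ⟨e1.some.trans e2.some.symm⟩

/-- The cosieve is the set of objects where `W` is empty. Then `i_*` and right Kan extension from
`D` are fully faithful with the same essential image, once `W` is moved along the equivalence with
presheaves. -/
lemma isPshOfCosieve_of_isClosedSubtoposOfFree {Z : Topos.{u}} (hZ : IsClosedSubtoposOfFree Z) :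
    IsPshOfCosieve Z := by
  obtain ⟨E, i, ⟨C, _, _, ⟨e⟩⟩, _, _, W, -, hW⟩ := hZ
  let W' := e.functor.obj W
  let D : ObjectProperty C := fun c => ¬ Nonempty (W'.obj (op c))
  have hD : IsCosieve D := fun d c h f ⟨x⟩ => h ⟨W'.map f.op x⟩
  refine ⟨C, _, inferInstance, D, hD,
    nonempty_equivalence_of_essImage_eq (GeomMor.direct i ⋙ e.functor) (extn D) ?_⟩
  funext P
  apply propext
  have h1 : (GeomMor.direct i ⋙ e.functor).essImage P ↔
      (GeomMor.direct i).essImage (e.inverse.obj P) := by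
    constructor
    · rintro ⟨X, ⟨a⟩⟩
      exact ⟨X, ⟨e.unitIso.app _ ≪≫ e.inverse.mapIso a⟩⟩
    · rintro ⟨X, ⟨a⟩⟩
      exact ⟨X, ⟨e.functor.mapIso a ≪≫ e.counitIso.app _⟩⟩
  have h2 (X : E) : (∃! _ : X ⟶ e.inverse.obj P, True) ↔ ∃! _ : e.functor.obj X ⟶ P, True := by
    let f := (e.toAdjunction.homEquiv X P)
    constructor
    · rintro ⟨a, -, ha⟩
      exact ⟨f.symm a, trivial, fun y _ => (Equiv.eq_symm_apply f).2 (ha _ trivial)⟩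
    · rintro ⟨a, -, ha⟩
      exact ⟨f a, trivial, fun y _ => (Equiv.symm_apply_eq f).1 (ha _ trivial)⟩
  rw [h1, hW, isIso_prod_snd_iff, essImage_extn_iff hD]
  simp only [D, not_not]
  rw [← psh_forall_iff P W']
  constructor
  · rintro h X ⟨w⟩
    have := (h2 _).1 (h (e.inverse.obj X) ⟨e.inverse.map w ≫ e.unitIso.inv.app W⟩)
    obtain ⟨a, -, ha⟩ := this
    refine ⟨e.counitIso.inv.app X ≫ a, trivial, fun y _ => ?_⟩
    rw [← ha (e.counitIso.hom.app X ≫ y) trivial]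
    simp
  · rintro h X ⟨w⟩
    exact (h2 X).2 (h _ ⟨e.functor.map w⟩)

end Closed

/-! ### Epimorphisms, images and strict initial objects in a topos -/

section ToposFacts

/-- Left adjoints preserve initial objects. -/
def _root_.CategoryTheory.Adjunction.isInitialObj {A B : Type*} [Category* A] [Category* B]
    {L : A ⥤ B} {R : B ⥤ A} (adj : L ⊣ R) {X : A} (h : IsInitial X) : IsInitial (L.obj X) :=
  IsInitial.ofUniqueHom (fun Y => (adj.homEquiv _ _).symm (h.to _)) fun Y m => by
    rw [Equiv.eq_symm_apply]
    exact h.hom_ext _ _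

variable {E : Topos.{u}}

/-- Epimorphisms of sheaves are the locally surjective maps. A local preimage under `g` of the image
of a section `s` pairs with the restriction of `s` to a section of the pullback. -/
lemma sheaf_epi_of_isPullback {C : Type u} [SmallCategory C] {J : GrothendieckTopology C}
    {P X Y Z : Sheaf J (Type u)} {fst : P ⟶ X} {snd : P ⟶ Y} {f : X ⟶ Z} {g : Y ⟶ Z}
    (h : IsPullback fst snd f g) [Epi g] : Epi fst := by
  have hg : Sheaf.IsLocallySurjective g := (Sheaf.isLocallySurjective_iff_epi g).2 inferInstance
  refine (Sheaf.isLocallySurjective_iff_epi fst).1 ⟨fun {U} s => ?_⟩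
  refine J.superset_covering ?_ (hg.imageSieve_mem (f.hom.app (op U) s))
  rintro V k ⟨t, ht⟩
  have hV : IsPullback (fst.hom.app (op V)) (snd.hom.app (op V)) (f.hom.app (op V))
      (g.hom.app (op V)) :=
    h.map (sheafToPresheaf J (Type u) ⋙ (evaluation _ _).obj (op V))
  obtain ⟨p, hp, -⟩ := Types.exists_of_isPullback hV (X.obj.map k.op s) t
    ((NatTrans.naturality_apply f.hom k.op s).trans ht.symm)
  exact ⟨p, hp⟩

/-- Epimorphisms in a topos are stable under pullback. -/
lemma epi_of_isPullback {P X Y Z : E} {fst : P ⟶ X} {snd : P ⟶ Y} {f : X ⟶ Z} {g : Y ⟶ Z}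
    (h : IsPullback fst snd f g) [Epi g] : Epi fst := by
  obtain ⟨C, _, J, ⟨e⟩⟩ := E.isGrothendieck
  have := sheaf_epi_of_isPullback (h.map e.functor)
  exact e.functor.epi_of_epi_map this

instance : Balanced E where
  isIso_of_mono_of_epi f _ _ := by
    obtain ⟨C, _, J, ⟨e⟩⟩ := E.isGrothendieck
    have : IsIso (e.functor.map f) := isIso_of_mono_of_epi _
    exact isIso_of_reflects_iso f e.functor

instance : HasStrictInitialObjects E where
  out {I A} f hI := by
    obtain ⟨C, _, J, ⟨e⟩⟩ := E.isGrothendieck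
    have : IsIso (e.functor.map f) := (e.toAdjunction.isInitialObj hI).isIso_to _
    exact isIso_of_reflects_iso f e.functor

/-- Epimorphisms in a topos are orthogonal to monomorphisms. -/
lemma exists_lift_of_epi {X Y A B : E} (e : Y ⟶ X) [Epi e] (m : A ⟶ B) [Mono m] (x : X ⟶ B)
    (y : Y ⟶ A) (h : e ≫ x = y ≫ m) : ∃ l : X ⟶ A, l ≫ m = x := by
  -- The pullback of `m` along `x` is mono, and it is epi because `e` factors through it;
  -- balancedness makes it invertible.
  have : Epi (pullback.fst x m) :=
    have : Epi (pullback.lift e y h ≫ pullback.fst x m) := by rwa [pullback.lift_fst]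
    epi_of_epi (pullback.lift e y h) _
  have : IsIso (pullback.fst x m) := isIso_of_mono_of_epi _
  exact ⟨inv (pullback.fst x m) ≫ pullback.snd x m, by
    rw [Category.assoc, ← pullback.condition, IsIso.inv_hom_id_assoc]⟩

/-- The forcing clause for existential quantifiers: membership in an image means a preimage after
passing to an epimorphic cover, here the pullback of the image factorization. -/
lemma imageSubobject_factors_iff {A B X : E} (g : A ⟶ B) (x : X ⟶ B) :
    (imageSubobject g).Factors x ↔ ∃ (Y : E) (e : Y ⟶ X) (_ : Epi e) (y : Y ⟶ A),
      y ≫ g = e ≫ x := by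
  constructor
  · intro h
    let l := (imageSubobject g).factorThru x h
    have : Epi (factorThruImageSubobject g) := inferInstance
    refine ⟨_, _, epi_of_isPullback (IsPullback.of_hasPullback l (factorThruImageSubobject g)),
      pullback.snd _ _, ?_⟩
    rw [← (imageSubobject g).factorThru_arrow x h, ← Category.assoc, pullback.condition,
      Category.assoc, imageSubobject_arrow_comp]
  · rintro ⟨Y, e, _, y, h⟩
    obtain ⟨l, hl⟩ := exists_lift_of_epi e (imageSubobject g).arrow x
      (y ≫ factorThruImageSubobject g) (by simp [h])
    rw [← hl]
    exact Subobject.factors_comp_arrow l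

/-- Falsum is factored through exactly by the maps out of initial objects. -/
lemma bot_factors_iff {A X : E} (x : X ⟶ A) :
    (imageSubobject (initial.to A)).Factors x ↔ Nonempty (IsInitial X) := by
  rw [imageSubobject_factors_iff]
  constructor
  · rintro ⟨Y, e, _, y, -⟩
    have hY : IsInitial Y := initialIsInitial.ofStrict y
    have : Mono e := hY.mono_from e
    have : IsIso e := isIso_of_mono_of_epi e
    exact ⟨hY.ofIso (asIso e)⟩
  · rintro ⟨hX⟩
    exact ⟨X, 𝟙 X, inferInstance, hX.to _, hX.hom_ext _ _⟩

end ToposFacts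

/-! ### Kripke–Joyal semantics and soundness -/

section Forcing

variable {S : Signature.{u}} {E : Topos.{u}} (M : Str S E)

/-- Generalized elements of the interpretation of a context. -/
abbrev Str.Env (X : E) (Γ : Ctx S) : Type u := ∀ i : Fin Γ.length, X ⟶ M.sort (Γ.get i)

variable {M}

def Str.Env.cons {X : E} {Γ : Ctx S} {s : S.Srt} (y : X ⟶ M.sort s) (x : M.Env X Γ) :
    M.Env X (s :: Γ) :=
  fun i => Fin.cases (motive := fun i => X ⟶ M.sort ((s :: Γ).get i)) y x i

def Str.Env.comp {X Y : E} (h : Y ⟶ X) {Γ : Ctx S} (x : M.Env X Γ) : M.Env Y Γ := fun i => h ≫ x i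

noncomputable def Term.eval {X : E} {Γ : Ctx S} (x : M.Env X Γ) : ∀ {s : S.Srt}, Term S Γ s → (X ⟶ M.sort s)
  | _, .var i => x i
  | _, .app o ts => Pi.lift (fun i => (ts i).eval x) ≫ M.op o

/-- Kripke–Joyal forcing. -/
def Forces : ∀ {X : E} {Γ : Ctx S}, M.Env X Γ → Formula S Γ → Prop
  | _, _, _, .top => True
  | X, _, _, .bot => Nonempty (IsInitial X)
  | _, _, x, .eq t t' => t.eval x = t'.eval x
  | _, _, x, .and φ ψ => Forces x φ ∧ Forces x ψ
  | X, _, x, .ex (s := s) φ =>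
      ∃ (Y : E) (e : Y ⟶ X) (_ : Epi e) (y : Y ⟶ M.sort s), Forces (.cons y (x.comp e)) φ

lemma Term.eval_eq {X : E} {Γ : Ctx S} (x : M.Env X Γ) {s : S.Srt} (t : Term S Γ s) :
    t.eval x = Pi.lift x ≫ t.interp M := by
  induction t with
  | var i => simp [eval, interp]
  | app o ts ih =>
    simp only [eval, interp, ih]
    rw [← Category.assoc]
    congr 1
    ext i
    simp

lemma Term.eval_comp {X Y : E} (h : Y ⟶ X) {Γ : Ctx S} (x : M.Env X Γ) {s : S.Srt}
    (t : Term S Γ s) : t.eval (x.comp h) = h ≫ t.eval x := by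
  rw [eval_eq, eval_eq, ← Category.assoc]
  congr 1
  ext i
  simp [Str.Env.comp]

/-- Precomposition of an environment with a substitution. -/
noncomputable def Str.Env.subst {X : E} {Γ Θ : Ctx S} (x : M.Env X Θ) (σ : Subst Γ Θ) : M.Env X Γ :=
  fun i => (σ i).eval x

lemma Term.eval_subst {X : E} {Γ Θ : Ctx S} (x : M.Env X Θ) (σ : Subst Γ Θ) {s : S.Srt}
    (t : Term S Γ s) : (t.subst σ).eval x = t.eval (x.subst σ) := by
  induction t with
  | var i => rfl
  | app o ts ih => simp only [subst, eval, ih]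

lemma Str.Env.subst_wk {X : E} {Γ : Ctx S} {s : S.Srt} (y : X ⟶ M.sort s) (x : M.Env X Γ) :
    (x.cons y).subst (wk s Γ) = x := rfl

lemma Str.Env.subst_cons {X : E} {Γ Θ : Ctx S} {s : S.Srt} (x : M.Env X Θ) (t : Term S Θ s)
    (σ : Subst Γ Θ) : x.subst (.cons t σ) = (x.subst σ).cons (t.eval x) := by
  funext i
  induction i using Fin.cases <;> rfl

lemma Str.Env.subst_comp {X Y : E} {Γ Θ : Ctx S} (x : M.Env X Θ) (σ : Subst Γ Θ) (h : Y ⟶ X) :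
    (x.subst σ).comp h = (x.comp h).subst σ := by
  funext i
  exact (Term.eval_comp h x (σ i)).symm

lemma Str.Env.subst_lift {X : E} {Γ Θ : Ctx S} {s : S.Srt} (y : X ⟶ M.sort s) (x : M.Env X Θ)
    (σ : Subst Γ Θ) : (x.cons y).subst (σ.lift s) = (x.subst σ).cons y := by
  funext i
  induction i using Fin.cases with
  | zero => rfl
  | succ i => exact (Term.eval_subst (x.cons y) (wk s Θ) (σ i))

lemma forces_subst {Γ : Ctx S} (φ : Formula S Γ) : ∀ {X : E} {Θ : Ctx S} (x : M.Env X Θ)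
    (σ : Subst Γ Θ), Forces x (φ.subst σ) ↔ Forces (x.subst σ) φ := by
  induction φ with
  | top => intros; rfl
  | bot => intros; rfl
  | eq t t' => intros; simp only [Formula.subst, Forces, Term.eval_subst]
  | and φ ψ ih ih' => intros; simp only [Formula.subst, Forces, ih, ih']
  | ex φ ih =>
    intro X Θ x σ
    simp only [Formula.subst, Forces, ih, Str.Env.subst_lift, Str.Env.subst_comp]

lemma Str.Env.lift_cons_proj {X : E} {Γ : Ctx S} {s : S.Srt} (y : X ⟶ M.sort s)
    (x : M.Env X Γ) : Pi.lift (x.cons y) ≫ M.proj s Γ = Pi.lift x := by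
  refine Limits.Pi.hom_ext _ _ fun i => ?_
  simp only [Category.assoc, Pi.lift_π, Str.proj]
  rfl

lemma Str.exists_env_cons {X : E} {Γ : Ctx S} {s : S.Srt} (z : X ⟶ M.ctx (s :: Γ)) :
    ∃ (y : X ⟶ M.sort s) (x : M.Env X Γ), z = Pi.lift (x.cons y) := by
  refine ⟨z ≫ Pi.π (fun i : Fin (s :: Γ).length => M.sort ((s :: Γ).get i)) 0,
    fun i => z ≫ Pi.π (fun i : Fin (s :: Γ).length => M.sort ((s :: Γ).get i)) i.succ, ?_⟩
  refine Limits.Pi.hom_ext _ _ fun i => ?_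
  rw [Pi.lift_π]
  induction i using Fin.cases <;> rfl

lemma env_eq_of_lift_eq {X : E} {Γ : Ctx S} {x x' : M.Env X Γ} (h : Pi.lift x = Pi.lift x') :
    x = x' := by
  funext i
  have := congrArg (· ≫ Pi.π _ i) h
  simpa only [Pi.lift_π] using this

/-- Forcing is factorization through the interpretation. -/
lemma interp_factors_iff {Γ : Ctx S} (φ : Formula S Γ) : ∀ {X : E} (x : M.Env X Γ),
    (φ.interp M).Factors (Pi.lift x) ↔ Forces x φ := by
  induction φ with
  | top => intros; simp [Formula.interp, Forces, Subobject.top_factors]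
  | bot => intros; simp only [Formula.interp, Forces, bot_factors_iff]
  | eq t t' =>
    intros
    simp only [Formula.interp, Forces, equalizerSubobject_factors_iff, Term.eval_eq]
  | and φ ψ ih ih' => intros; simp only [Formula.interp, Forces, Subobject.inf_factors, ih, ih']
  | @ex Γ s φ ih =>
    intro X x
    simp only [Formula.interp, Forces, imageSubobject_factors_iff]
    constructor
    · rintro ⟨Y, e, he, y, h⟩
      obtain ⟨y', x', hz⟩ := M.exists_env_cons (y ≫ (φ.interp M).arrow)
      refine ⟨Y, e, he, y', ?_⟩
      have : x.comp e = x' := env_eq_of_lift_eq (by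
        rw [← x'.lift_cons_proj y', ← hz, Category.assoc, h]
        exact Limits.Pi.hom_ext _ _ fun i => by simp [Str.Env.comp])
      rw [this, ← ih, ← hz]
      exact Subobject.factors_comp_arrow y
    · rintro ⟨Y, e, he, y, h⟩
      rw [← ih] at h
      refine ⟨Y, e, he, (φ.interp M).factorThru _ h, ?_⟩
      rw [← Category.assoc, Subobject.factorThru_arrow, Str.Env.lift_cons_proj]
      exact Limits.Pi.hom_ext _ _ fun i => by simp [Str.Env.comp]

lemma env_eq_of_lift {X : E} {Γ : Ctx S} (z : X ⟶ M.ctx Γ) :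
    z = Pi.lift (fun i => z ≫ Pi.π _ i : M.Env X Γ) :=
  Limits.Pi.hom_ext _ _ fun i => by simp

lemma Forces.comp {X Y : E} {Γ : Ctx S} {x : M.Env X Γ} {φ : Formula S Γ} (h : Forces x φ)
    (f : Y ⟶ X) : Forces (x.comp f) φ := by
  rw [← interp_factors_iff] at h ⊢
  have : Pi.lift (x.comp f) = f ≫ Pi.lift x :=
    Limits.Pi.hom_ext _ _ fun i => by simp [Str.Env.comp]
  rw [this]
  exact Subobject.factors_of_factors_right f h

lemma Forces.of_epi {X Y : E} {Γ : Ctx S} {x : M.Env X Γ} {φ : Formula S Γ} (f : Y ⟶ X) [Epi f]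
    (h : Forces (x.comp f) φ) : Forces x φ := by
  rw [← interp_factors_iff] at h ⊢
  have : Pi.lift (x.comp f) = f ≫ Pi.lift x :=
    Limits.Pi.hom_ext _ _ fun i => by simp [Str.Env.comp]
  rw [this] at h
  obtain ⟨l, hl⟩ := exists_lift_of_epi f (φ.interp M).arrow (Pi.lift x)
    ((φ.interp M).factorThru _ h) (Subobject.factorThru_arrow _ _ _).symm
  rw [← hl]
  exact Subobject.factors_comp_arrow l

lemma interp_le_iff {Γ : Ctx S} (φ ψ : Formula S Γ) :
    φ.interp M ≤ ψ.interp M ↔ ∀ {X : E} (x : M.Env X Γ), Forces x φ → Forces x ψ := by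
  constructor
  · intro h X x hx
    rw [← interp_factors_iff] at hx ⊢
    exact Subobject.factors_of_le _ h hx
  · intro h
    apply Subobject.le_of_factors
    rw [env_eq_of_lift (φ.interp M).arrow, interp_factors_iff]
    apply h
    rw [← interp_factors_iff, ← env_eq_of_lift]
    exact Subobject.factors_self _

lemma isModel_iff (T : Theory S) :
    IsModel M T ↔ ∀ σ ∈ T, ∀ {X : E} (x : M.Env X σ.ctx), Forces x σ.hyp → Forces x σ.concl := by
  simp only [IsModel, interp_le_iff]

/-- Soundness. -/
lemma Derivable.sound {T : Theory S} (hM : IsModel M T) {Γ : Ctx S} {φ ψ : Formula S Γ}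
    (h : Derivable T φ ψ) : ∀ {X : E} (x : M.Env X Γ), Forces x φ → Forces x ψ := by
  induction h with
  | ax σ hσ => exact (isModel_iff T).1 hM σ hσ
  | refl => exact fun _ h => h
  | cut _ _ ih ih' => exact fun x h => ih' x (ih x h)
  | subst σ _ ih =>
    intro X x h
    rw [forces_subst] at h ⊢
    exact ih _ h
  | top => exact fun _ _ => trivial
  | bot φ =>
    rintro X x ⟨hX⟩
    refine Forces.of_epi (Y := X) (𝟙 X) ?_
    rw [← interp_factors_iff]
    have : Pi.lift (x.comp (𝟙 X)) = hX.to _ ≫ (φ.interp M).arrow := hX.hom_ext _ _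
    rw [this]
    exact Subobject.factors_comp_arrow _
  | andLeft => exact fun _ h => h.1
  | andRight => exact fun _ h => h.2
  | andIntro _ _ ih ih' => exact fun x h => ⟨ih x h, ih' x h⟩
  | eqRefl => exact fun _ _ => rfl
  | eqSubst t t' φ =>
    rintro X x ⟨h, h'⟩
    rw [forces_subst, Str.Env.subst_cons] at h' ⊢
    rwa [show t.eval x = t'.eval x from h] at h'
  | exElim _ ih =>
    rintro X x ⟨Y, e, _, y, h⟩
    have := ih _ h
    rw [forces_subst, Str.Env.subst_wk] at this
    exact this.of_epi e
  | @exIntro Γ s φ ψ _ ih =>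
    intro X x h
    rw [forces_subst]
    refine ih _ ⟨X, 𝟙 X, inferInstance, x 0, ?_⟩
    convert h using 1
    funext i
    induction i using Fin.cases with
    | zero => rfl
    | succ i => exact Category.id_comp _
  | frobenius φ ψ =>
    rintro X x ⟨h, Y, e, he, y, h'⟩
    refine ⟨Y, e, he, y, ?_, h'⟩
    rw [forces_subst, Str.Env.subst_wk]
    exact h.comp e

/-- A formula has at most one witness for its first variable in the structure `M`. -/
def UniqueWitness (M : Str S E) {Γ : Ctx S} {s : S.Srt} (φ : Formula S (s :: Γ)) : Prop :=
  ∀ {X : E} (x : M.Env X Γ) (y y' : X ⟶ M.sort s),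
    Forces (x.cons y) φ → Forces (x.cons y') φ → y = y'

lemma ProvablyUnique.uniqueWitness {T : Theory S} (hM : IsModel M T) {Γ : Ctx S} {s : S.Srt}
    {φ : Formula S (s :: Γ)} (h : ProvablyUnique T φ) : UniqueWitness M φ := by
  intro X x y y' hy hy'
  exact h.sound hM ((x.cons y').cons y) ⟨(forces_subst φ _ _).2 ((Str.Env.subst_cons _ _ _) ▸ hy),
    (forces_subst φ _ _).2 ((Str.Env.subst_cons _ _ _) ▸ hy')⟩

/-- Unique witnesses exist globally. -/
lemma forces_ex_iff {Γ : Ctx S} {s : S.Srt} {φ : Formula S (s :: Γ)} (h : UniqueWitness M φ)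
    {X : E} (x : M.Env X Γ) : Forces x (.ex φ) ↔ ∃ y : X ⟶ M.sort s, Forces (x.cons y) φ := by
  constructor
  · rintro ⟨Y, e, _, y, hy⟩
    -- Uniqueness of witnesses makes the projection from the extension of `φ` mono, so a witness
    -- over the cover `e` descends by orthogonality of epis and monos.
    have : Mono ((φ.interp M).arrow ≫ M.proj s Γ) := by
      refine ⟨fun {W} a b hab => ?_⟩
      obtain ⟨ya, xa, ha⟩ := M.exists_env_cons (a ≫ (φ.interp M).arrow)
      obtain ⟨yb, xb, hb⟩ := M.exists_env_cons (b ≫ (φ.interp M).arrow)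
      have hx : xa = xb := env_eq_of_lift_eq (by
        rw [← xa.lift_cons_proj ya, ← xb.lift_cons_proj yb, ← ha, ← hb, Category.assoc, hab,
          Category.assoc])
      subst hx
      have hy : ya = yb := h xa ya yb
        ((interp_factors_iff φ _).1 (ha ▸ Subobject.factors_comp_arrow a))
        ((interp_factors_iff φ _).1 (hb ▸ Subobject.factors_comp_arrow b))
      subst hy
      rw [← cancel_mono (φ.interp M).arrow, ha, hb]
    have hy' := (interp_factors_iff φ _).2 hy
    obtain ⟨l, hl⟩ := exists_lift_of_epi e ((φ.interp M).arrow ≫ M.proj s Γ) (Pi.lift x)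
      ((φ.interp M).factorThru _ hy') (by
        rw [← Category.assoc, Subobject.factorThru_arrow, Str.Env.lift_cons_proj]
        exact Limits.Pi.hom_ext _ _ fun i => by simp [Str.Env.comp])
    obtain ⟨y', x', hz⟩ := M.exists_env_cons (l ≫ (φ.interp M).arrow)
    have hx : x = x' := env_eq_of_lift_eq (by
      rw [← x'.lift_cons_proj y', ← hz, Category.assoc, hl])
    subst hx
    exact ⟨y', (interp_factors_iff φ _).1 (hz ▸ Subobject.factors_comp_arrow l)⟩
  · rintro ⟨y, hy⟩
    refine ⟨X, 𝟙 X, inferInstance, y, ?_⟩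
    convert hy using 2
    funext i
    exact Category.id_comp _

end Forcing

/-! ### Natural transformations determined on a dense subcategory -/

section Density

variable {A Z Y : Type*} [Category* A] [Category* Z] [Category* Y] {v : A ⥤ Z} [v.IsDense]

lemma dense_ext {K : Z ⥤ Z} {α β : 𝟭 Z ⟶ K} (h : ∀ a, α.app (v.obj a) = β.app (v.obj a)) :
    α = β :=
  Functor.hom_ext_of_isLeftKanExtension _ v.rightUnitor.inv _ _ (by ext a; simp [h])

lemma dense_exists {K : Z ⥤ Z} (γ : v ⟶ v ⋙ K) :
    ∃ α : 𝟭 Z ⟶ K, ∀ a, α.app (v.obj a) = γ.app a :=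
  ⟨Functor.descOfIsLeftKanExtension _ v.rightUnitor.inv K γ, fun a => by
    have := Functor.descOfIsLeftKanExtension_fac_app (𝟭 Z) v.rightUnitor.inv K γ a
    simpa using this⟩

/-- Transposing turns transformations `L ⟶ H` into transformations `𝟭 Z ⟶ H ⋙ R`, and the identity
is the left Kan extension of a dense functor along itself. -/
lemma leftAdjoint_ext {L H : Z ⥤ Y} {R : Y ⥤ Z} (adj : L ⊣ R) {α β : L ⟶ H}
    (h : ∀ a, α.app (v.obj a) = β.app (v.obj a)) : α = β := by
  have : adj.unit ≫ Functor.whiskerRight α R = adj.unit ≫ Functor.whiskerRight β R :=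
    dense_ext (v := v) fun a => by simp [h]
  ext A
  apply (adj.homEquiv _ _).injective
  simpa [Adjunction.homEquiv_unit] using NatTrans.congr_app this A

lemma leftAdjoint_exists {L H : Z ⥤ Y} {R : Y ⥤ Z} (adj : L ⊣ R) (γ : v ⋙ L ⟶ v ⋙ H) :
    ∃ α : L ⟶ H, ∀ a, α.app (v.obj a) = γ.app a := by
  obtain ⟨α, hα⟩ := dense_exists (v := v) (K := H ⋙ R)
    { app := fun a => (adj.homEquiv _ _) (γ.app a)
      naturality := fun a b f => by
        rw [← adj.homEquiv_naturality_left]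
        refine Eq.trans ?_ (adj.homEquiv_naturality_right _ _)
        exact congrArg _ (γ.naturality f) }
  refine ⟨{ app := fun A => (adj.homEquiv _ _).symm (α.app A), naturality := fun A B f => ?_ },
    fun a => ?_⟩
  · rw [← adj.homEquiv_naturality_left_symm, ← adj.homEquiv_naturality_right_symm]
    exact congrArg _ (α.naturality f)
  · exact (Equiv.symm_apply_eq _).2 (hα a)

end Density

/-! ### Models under direct images of dominant morphisms -/

section Push

variable {S : Signature.{u}} {E F : Topos.{u}}

instance preservesFiniteLimits_direct (f : E ⟶ F) : PreservesFiniteLimits (GeomMor.direct f) :=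
  have : PreservesLimitsOfSize.{0, 0} (GeomMor.direct f) :=
    (GeomMor.adj f).rightAdjoint_preservesLimits
  PreservesLimitsOfSize.preservesFiniteLimits _

/-- The structure `f_* M` obtained by applying the direct image of `f`. -/
noncomputable def Str.push (M : Str S E) (f : E ⟶ F) : Str S F where
  sort s := (GeomMor.direct f).obj (M.sort s)
  op o := (PreservesProduct.iso (GeomMor.direct f)
      (fun i : Fin (S.dom o).length => M.sort ((S.dom o).get i))).inv ≫
    (GeomMor.direct f).map (M.op o)

lemma homEquiv_symm_lift_comp_iso_inv (f : E ⟶ F) {X : F} {n : ℕ} {Y : Fin n → E}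
    (a : ∀ i, X ⟶ (GeomMor.direct f).obj (Y i)) :
    ((GeomMor.adj f).homEquiv X (∏ᶜ Y)).symm
        (Pi.lift a ≫ (PreservesProduct.iso (GeomMor.direct f) Y).inv) =
      Pi.lift fun i => ((GeomMor.adj f).homEquiv X (Y i)).symm (a i) := by
  refine Limits.Pi.hom_ext _ _ fun i => ?_
  rw [← (GeomMor.adj f).homEquiv_naturality_right_symm, Pi.lift_π]
  refine congrArg _ ?_
  refine Eq.trans ?_ (Pi.lift_π a i)
  rw [Category.assoc]
  refine congrArg (_ ≫ ·) ?_
  rw [Iso.inv_comp_eq]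
  simp

variable {M : Str S E} {f : E ⟶ F}

/-- The transpose of an environment in `f_* M`. -/
def Str.Env.transpose {X : F} {Γ : Ctx S} (x : (M.push f).Env X Γ) :
    M.Env ((GeomMor.inverse f).obj X) Γ :=
  fun i => ((GeomMor.adj f).homEquiv X _).symm (x i)

lemma Term.eval_transpose {X : F} {Γ : Ctx S} (x : (M.push f).Env X Γ) {s : S.Srt}
    (t : Term S Γ s) :
    t.eval x.transpose = ((GeomMor.adj f).homEquiv X (M.sort s)).symm (t.eval x) := by
  induction t with
  | var i => rfl
  | app o ts ih =>
    have h1 : (app o ts).eval x = (Pi.lift (fun i => (ts i).eval x) ≫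
        (PreservesProduct.iso (GeomMor.direct f)
          (fun i : Fin (S.dom o).length => M.sort ((S.dom o).get i))).inv) ≫
        (GeomMor.direct f).map (M.op o) := (Category.assoc _ _ _).symm
    rw [h1]
    refine Eq.trans ?_ ((GeomMor.adj f).homEquiv_naturality_right_symm _ _).symm
    refine congrArg (· ≫ M.op o) ?_
    simp only [ih]
    exact (homEquiv_symm_lift_comp_iso_inv f _).symm

lemma Str.Env.transpose_cons {X : F} {Γ : Ctx S} {s : S.Srt} (y : X ⟶ (M.push f).sort s)
    (x : (M.push f).Env X Γ) :
    (x.cons y).transpose = x.transpose.cons (((GeomMor.adj f).homEquiv X (M.sort s)).symm y) := by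
  funext i
  induction i using Fin.cases <;> rfl

/-- The unit maps `X` to `f_* f^* X`, which is initial by dominance; strictness does the rest. This
is the point where falsum needs dominance. -/
lemma isInitial_of_inverse (hf : IsDominant f) {X : F}
    (h : IsInitial ((GeomMor.inverse f).obj X)) : Nonempty (IsInitial X) := by
  have : PreservesColimitsOfShape (Discrete PEmpty.{1}) (GeomMor.direct f) := hf
  exact ⟨IsInitial.ofStrict ((GeomMor.adj f).unit.app X) (h.isInitialObj (GeomMor.direct f))⟩

/-- Dominant direct images preserve and reflect forcing of formulas with unique existential
quantifiers. -/
lemma forces_push_iff (hf : IsDominant f) {T : Theory S} (hM : IsModel M T) {Γ : Ctx S}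
    (φ : Formula S Γ) (hφ : UniqueEx T φ) :
    ∀ {X : F} (x : (M.push f).Env X Γ), Forces x φ ↔ Forces x.transpose φ := by
  induction φ with
  | top => intros; rfl
  | bot =>
    intro X x
    exact ⟨fun ⟨h⟩ => ⟨(GeomMor.adj f).isInitialObj h⟩, fun ⟨h⟩ => isInitial_of_inverse hf h⟩
  | eq t t' =>
    intro X x
    simp only [Forces, Term.eval_transpose]
    exact (Equiv.apply_eq_iff_eq _).symm
  | and φ ψ ih ih' =>
    intro X x
    simp only [Forces, ih hφ.1, ih' hφ.2]
  | @ex Γ s φ ih =>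
    intro X x
    have hu : UniqueWitness M φ := hφ.2.uniqueWitness hM
    -- Direct images need not preserve epimorphisms, so local witnesses do not transpose. Uniqueness
    -- holds on both sides and makes all witnesses global, and global witnesses transpose.
    have hu' : UniqueWitness (M.push f) φ := by
      intro X x y y' hy hy'
      rw [ih hφ.1, Str.Env.transpose_cons] at hy hy'
      exact ((GeomMor.adj f).homEquiv X (M.sort s)).symm.injective (hu _ _ _ hy hy')
    rw [forces_ex_iff hu, forces_ex_iff hu']
    constructor
    · rintro ⟨y, hy⟩
      rw [ih hφ.1, Str.Env.transpose_cons] at hy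
      exact ⟨_, hy⟩
    · rintro ⟨y, hy⟩
      refine ⟨(GeomMor.adj f).homEquiv X (M.sort s) y, (ih hφ.1 _).2 ?_⟩
      refine (Str.Env.transpose_cons _ _).symm ▸ ?_
      rwa [Equiv.symm_apply_apply]

/-- Direct images of dominant geometric morphisms preserve models of essentially algebraic theories
with falsum. -/
lemma isModel_push (hf : IsDominant f) {T : Theory S} (hT : IsEssAlgWithFalsum T)
    (hM : IsModel M T) : IsModel (M.push f) T := by
  rw [isModel_iff]
  intro σ hσ X x h
  rw [forces_push_iff hf hM _ (hT σ hσ).1] at h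
  rw [forces_push_iff hf hM _ (hT σ hσ).2]
  exact (isModel_iff T).1 hM σ hσ _ h

end Push

/-! ### Homomorphisms and forcing -/

section Hom

variable {S : Signature.{u}} {E : Topos.{u}} {M N : Str S E}

def Str.Env.map (α : M ⟶ N) {X : E} {Γ : Ctx S} (x : M.Env X Γ) : N.Env X Γ :=
  fun i => x i ≫ Str.Hom.map α (Γ.get i)

lemma Term.eval_map (α : M ⟶ N) {X : E} {Γ : Ctx S} (x : M.Env X Γ) {s : S.Srt}
    (t : Term S Γ s) : t.eval (x.map α) = t.eval x ≫ Str.Hom.map α s := by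
  induction t with
  | var i => rfl
  | app o ts ih =>
    have h := Str.Hom.comm α o
    simp only [eval, ih, Category.assoc, ← h]
    rw [← Category.assoc]
    congr 1
    ext i
    simp

/-- Homomorphisms preserve forcing. -/
lemma Forces.map (α : M ⟶ N) {Γ : Ctx S} (φ : Formula S Γ) : ∀ {X : E} {x : M.Env X Γ},
    Forces x φ → Forces (x.map α) φ := by
  induction φ with
  | top => exact fun _ => trivial
  | bot => exact fun h => h
  | eq t t' =>
    intro X x h
    simp only [Forces, Term.eval_map] at h ⊢
    rw [h]
  | and φ ψ ih ih' => exact fun h => ⟨ih h.1, ih' h.2⟩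
  | @ex Γ s φ ih =>
    rintro X x ⟨Y, e, he, y, h⟩
    refine ⟨Y, e, he, y ≫ Str.Hom.map α s, ?_⟩
    convert ih h using 1
    funext i
    induction i using Fin.cases with
    | zero => rfl
    | succ i => exact (Category.assoc _ _ _).symm

lemma IsModel.of_iso {T : Theory S} (hM : IsModel M T) (e : M ≅ N) : IsModel N T := by
  rw [isModel_iff] at hM ⊢
  intro σ hσ X x h
  have := (hM σ hσ _ (h.map e.inv)).map e.hom
  convert this using 1
  funext i
  have h1 : Str.Hom.map e.inv _ ≫ Str.Hom.map e.hom (σ.ctx.get i) = 𝟙 _ :=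
    congrArg (fun α => Str.Hom.map α (σ.ctx.get i)) e.inv_hom_id
  exact (Category.comp_id _).symm.trans ((congrArg (x i ≫ ·) h1.symm).trans
    (Category.assoc _ _ _).symm)

end Hom

/-! ### The theory of left exact functors vanishing off a cosieve -/

section CatTheory

/-- The sequent expressing that `φ` has at most one witness. -/
def uniqSeq {S : Signature.{u}} {Γ : Ctx S} {s : S.Srt} (φ : Formula S (s :: Γ)) : Sequent S where
  ctx := s :: s :: Γ
  hyp := .and
    (φ.subst (.cons (Term.var (Γ := s :: s :: Γ) (0 : Fin (Γ.length + 2)))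
      fun i => Term.var (Γ := s :: s :: Γ) i.succ.succ))
    (φ.subst (.cons (Term.var (Γ := s :: s :: Γ) (1 : Fin (Γ.length + 2)))
      fun i => Term.var (Γ := s :: s :: Γ) i.succ.succ))
  concl := .eq (Term.var (Γ := s :: s :: Γ) (0 : Fin (Γ.length + 2)))
    (Term.var (Γ := s :: s :: Γ) (1 : Fin (Γ.length + 2)))

/-- `uniqSeq φ` unfolds to the very sequent that `ProvablyUnique` asks for, so adding it as an axiom
licenses the quantifier over `φ`. -/
lemma provablyUnique_of_mem {S : Signature.{u}} {T : Theory S} {Γ : Ctx S} {s : S.Srt}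
    {φ : Formula S (s :: Γ)} (h : uniqSeq φ ∈ T) : ProvablyUnique T φ :=
  Derivable.ax _ h

lemma forces_uniqSeq {S : Signature.{u}} {E : Topos.{u}} {M : Str S E} {Γ : Ctx S} {s : S.Srt}
    {φ : Formula S (s :: Γ)} (h : UniqueWitness M φ) {X : E} (x : M.Env X (uniqSeq φ).ctx)
    (hx : Forces x (uniqSeq φ).hyp) : Forces x (uniqSeq φ).concl := by
  refine h (fun i => x i.succ.succ) (x (0 : Fin (Γ.length + 2))) (x (1 : Fin (Γ.length + 2))) ?_ ?_
  · convert (forces_subst φ _ _).1 hx.1 using 1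
    funext i
    induction i using Fin.cases <;> rfl
  · convert (forces_subst φ _ _).1 hx.2 using 1
    funext i
    induction i using Fin.cases <;> rfl

variable (C : Type u) [SmallCategory C]

/-- The signature with the objects of `C` as sorts and its morphisms as operations. -/
abbrev catSig : Signature.{u} where
  Srt := C
  Op := Σ c d : C, (c ⟶ d)
  dom f := [f.1]
  cod f := f.2.1

variable {C}

/-- Apply a morphism to a term. -/
def mapTerm {Γ : Ctx (catSig C)} {c d : C} (f : c ⟶ d) (t : Term (catSig C) Γ c) :
    Term (catSig C) Γ d :=
  Term.app (S := catSig C) ⟨c, d, f⟩ (Subst.cons (S := catSig C) (Γ := []) t fun i => i.elim0)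

/-- The first variable of a context. -/
def var₀ {S : Signature.{u}} {s : S.Srt} {Γ : Ctx S} : Term S (s :: Γ) s :=
  Term.var (Γ := s :: Γ) (0 : Fin (Γ.length + 1))

/-- The second variable of a context. -/
def var₁ {S : Signature.{u}} {s s' : S.Srt} {Γ : Ctx S} : Term S (s :: s' :: Γ) s' :=
  Term.var (Γ := s :: s' :: Γ) (1 : Fin (Γ.length + 2))

/-- The third variable of a context. -/
def var₂ {S : Signature.{u}} {s s' s'' : S.Srt} {Γ : Ctx S} : Term S (s :: s' :: s'' :: Γ) s'' :=
  Term.var (Γ := s :: s' :: s'' :: Γ) (2 : Fin (Γ.length + 3))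

section

variable [HasFiniteLimits C]

/-- The formula describing elements of a pullback. -/
noncomputable def pullbackFormula {a b c : C} (f : a ⟶ c) (g : b ⟶ c) :
    Formula (catSig C) (pullback f g :: [a, b]) :=
  .and (.eq (mapTerm (pullback.fst f g) var₀) var₁) (.eq (mapTerm (pullback.snd f g) var₀) var₂)

/-- The axioms of the theory of left exact functors on `C` which vanish off `D`. -/
inductive CatAx (D : ObjectProperty C) : Sequent (catSig C) → Prop
  | id (c : C) : CatAx D ⟨[c], .top, .eq (mapTerm (𝟙 c) var₀) var₀⟩
  | comp {c d e : C} (f : c ⟶ d) (g : d ⟶ e) :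
      CatAx D ⟨[c], .top, .eq (mapTerm (f ≫ g) var₀) (mapTerm g (mapTerm f var₀))⟩
  | terminal : CatAx D ⟨[], .top, .ex (s := (⊤_ C : C)) .top⟩
  | terminalUniq : CatAx D (uniqSeq (S := catSig C) (Γ := []) (s := (⊤_ C : C)) .top)
  | pullback {a b c : C} (f : a ⟶ c) (g : b ⟶ c) :
      CatAx D ⟨[a, b], .eq (mapTerm f var₀) (mapTerm g var₁), .ex (pullbackFormula f g)⟩
  | pullbackUniq {a b c : C} (f : a ⟶ c) (g : b ⟶ c) : CatAx D (uniqSeq (pullbackFormula f g))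
  | empty (c : C) : ¬ D c → CatAx D ⟨[c], .top, .bot⟩

/-- The theory of left exact functors on `C` which vanish off `D`. -/
def catTheory (D : ObjectProperty C) : Theory (catSig C) := {σ | CatAx D σ}

lemma isEssAlgWithFalsum_catTheory (D : ObjectProperty C) :
    IsEssAlgWithFalsum (catTheory D) := by
  intro σ hσ
  cases hσ with
  | id c => exact ⟨trivial, trivial⟩
  | comp f g => exact ⟨trivial, trivial⟩
  | terminal => exact ⟨trivial, trivial, provablyUnique_of_mem (CatAx.terminalUniq)⟩
  | terminalUniq => exact ⟨⟨trivial, trivial⟩, trivial⟩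
  | pullback f g => exact ⟨trivial, ⟨trivial, trivial⟩, provablyUnique_of_mem (CatAx.pullbackUniq f g)⟩
  | pullbackUniq f g => exact ⟨⟨⟨trivial, trivial⟩, trivial, trivial⟩, trivial⟩
  | empty c h => exact ⟨trivial, trivial⟩

end

variable {E : Topos.{u}}

/-- The empty environment. -/
def Str.Env.nil {S : Signature.{u}} (M : Str S E) (X : E) : M.Env X [] := fun i => i.elim0

/-- The interpretation of a context with one variable. -/
noncomputable def Str.ctxSingle {S : Signature.{u}} (M : Str S E) (s : S.Srt) :
    M.ctx [s] ≅ M.sort s where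
  hom := Pi.π (fun i : Fin [s].length => M.sort ([s].get i)) 0
  inv := Pi.lift ((Str.Env.nil M (M.sort s)).cons (𝟙 (M.sort s)))
  hom_inv_id := by
    refine Limits.Pi.hom_ext _ _ fun i => ?_
    refine (Category.assoc _ _ _).trans ((congrArg (_ ≫ ·) (Pi.lift_π _ _)).trans ?_)
    induction i using Fin.cases with
    | zero => exact (Category.comp_id _).trans (Category.id_comp _).symm
    | succ i => exact i.elim0
  inv_hom_id := Pi.lift_π _ _

lemma Str.lift_single {S : Signature.{u}} (M : Str S E) {s : S.Srt} {X : E} (x : M.Env X [s]) :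
    Pi.lift x = (show X ⟶ M.sort s from x 0) ≫ (M.ctxSingle s).inv := by
  rw [Iso.eq_comp_inv]
  exact Pi.lift_π _ _

/-- The action of a structure for `catSig C` on a morphism of `C`. -/
noncomputable def Str.opMap (M : Str (catSig C) E) {c d : C} (f : c ⟶ d) :
    M.sort c ⟶ M.sort d :=
  (M.ctxSingle (S := catSig C) c).inv ≫ M.op ⟨c, d, f⟩

lemma eval_mapTerm (M : Str (catSig C) E) {Γ : Ctx (catSig C)} {c d : C} (f : c ⟶ d)
    (t : Term (catSig C) Γ c) {X : E} (x : M.Env X Γ) :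
    (mapTerm f t).eval x = t.eval x ≫ M.opMap f := by
  refine Eq.trans ?_ (Category.assoc _ _ _)
  exact congrArg (· ≫ M.op ⟨c, d, f⟩) (M.lift_single (S := catSig C) (s := c) _)

/-- The structure given by a functor out of `C`. -/
noncomputable def strOf (N : C ⥤ E) : Str (catSig C) E where
  sort c := N.obj c
  op f := Pi.π (fun i : Fin [f.1].length => N.obj ([f.1].get i)) (0 : Fin 1) ≫ N.map f.2.2

lemma opMap_strOf (N : C ⥤ E) {c d : C} (f : c ⟶ d) : (strOf N).opMap f = N.map f :=
  ((strOf N).ctxSingle (S := catSig C) c).inv_hom_id_assoc (N.map f)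

lemma op_eq_opMap (M : Str (catSig C) E) (f : (catSig C).Op) :
    M.op f = (M.ctxSingle (S := catSig C) f.1).hom ≫ M.opMap f.2.2 :=
  ((M.ctxSingle (S := catSig C) f.1).hom_inv_id_assoc (M.op f)).symm

lemma map_ctxSingle_hom {S : Signature.{u}} {M M' : Str S E} (α : ∀ s, M.sort s ⟶ M'.sort s)
    (s : S.Srt) : Limits.Pi.map (fun i : Fin [s].length => α ([s].get i)) ≫ (M'.ctxSingle s).hom =
      (M.ctxSingle s).hom ≫ α s :=
  Pi.map_π (f := fun i : Fin [s].length => M.sort ([s].get i)) _ _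

/-- Natural transformations are homomorphisms. -/
noncomputable def strOfMap {N N' : C ⥤ E} (α : N ⟶ N') : strOf N ⟶ strOf N' :=
  Str.Hom.mk (fun c => α.app c) fun f => by
    refine (Category.assoc _ _ _).symm.trans ?_
    refine (congrArg (· ≫ N'.map f.2.2) (map_ctxSingle_hom (S := catSig C) (M := strOf N)
      (M' := strOf N') (fun c => α.app c) f.1)).trans ?_
    refine (Category.assoc _ _ _).trans ?_
    refine (congrArg (_ ≫ ·) (α.naturality f.2.2).symm).trans ?_
    exact (Category.assoc _ _ _).symm

lemma opMap_comm {M M' : Str (catSig C) E} (α : M ⟶ M') {c d : C} (f : c ⟶ d) :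
    M.opMap f ≫ Str.Hom.map α d = Str.Hom.map α c ≫ M'.opMap f := by
  have h := map_ctxSingle_hom (S := catSig C) (M := M) (M' := M') (Str.Hom.map α) c
  refine (Category.assoc _ _ _).trans ?_
  refine (congrArg (_ ≫ ·) (Str.Hom.comm α ⟨c, d, f⟩).symm).trans ?_
  refine (Category.assoc _ _ _).symm.trans ?_
  refine Eq.trans ?_ (Category.assoc _ _ _)
  refine congrArg (· ≫ M'.op ⟨c, d, f⟩) ?_
  exact (Iso.inv_comp_eq _).2 ((Iso.eq_comp_inv _).2 h |>.trans (Category.assoc _ _ _))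

variable [HasFiniteLimits C] {D : ObjectProperty C}

lemma isModel_strOf (N : C ⥤ E) [PreservesFiniteLimits N]
    (hN : ∀ c, ¬ D c → Nonempty (IsInitial (N.obj c))) : IsModel (strOf N) (catTheory D) := by
  have hpb {a b c : C} (f : a ⟶ c) (g : b ⟶ c) :
      IsPullback (N.map (pullback.fst f g)) (N.map (pullback.snd f g)) (N.map f) (N.map g) :=
    (IsPullback.of_hasPullback f g).map N
  have ht : IsTerminal (N.obj (⊤_ C)) := terminalIsTerminal.isTerminalObj N
  rw [isModel_iff]
  intro σ hσ X x hx
  cases hσ with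
  | id c =>
    change Term.eval _ _ = Term.eval _ _
    rw [eval_mapTerm, opMap_strOf, N.map_id]
    exact Category.comp_id _
  | comp f g =>
    change Term.eval _ _ = Term.eval _ _
    rw [eval_mapTerm, eval_mapTerm, eval_mapTerm, opMap_strOf, opMap_strOf, opMap_strOf, N.map_comp]
    exact (Category.assoc _ _ _).symm
  | terminal => exact ⟨X, 𝟙 X, inferInstance, ht.from X, trivial⟩
  | terminalUniq => exact forces_uniqSeq (fun _ _ _ _ _ => ht.hom_ext _ _) x hx
  | pullback f g =>
    change Term.eval _ _ = Term.eval _ _ at hx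
    rw [eval_mapTerm, eval_mapTerm, opMap_strOf, opMap_strOf] at hx
    refine ⟨X, 𝟙 X, inferInstance, (hpb f g).lift _ _ hx, ?_, ?_⟩
    · change Term.eval _ _ = Term.eval _ _
      rw [eval_mapTerm, opMap_strOf]
      exact ((hpb f g).lift_fst _ _ hx).trans (Category.id_comp _).symm
    · change Term.eval _ _ = Term.eval _ _
      rw [eval_mapTerm, opMap_strOf]
      exact ((hpb f g).lift_snd _ _ hx).trans (Category.id_comp _).symm
  | pullbackUniq f g =>
    refine forces_uniqSeq (fun {Y} x y y' hy hy' => ?_) x hx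
    obtain ⟨h1, h2⟩ := hy
    obtain ⟨h1', h2'⟩ := hy'
    change Term.eval _ _ = Term.eval _ _ at h1 h2 h1' h2'
    rw [eval_mapTerm, opMap_strOf] at h1 h2 h1' h2'
    exact (hpb f g).hom_ext (h1.trans h1'.symm) (h2.trans h2'.symm)
  | empty c h =>
    obtain ⟨hi⟩ := hN c h
    exact ⟨IsInitial.ofStrict (x 0) hi⟩

/-- The existence axiom gives a local pairing of a compatible pair, and the uniqueness axiom makes
it global and unique. Commutativity of the square enters as `hw` because it comes from the axioms of
functoriality. -/
lemma isPullback_opMap {M : Str (catSig C) E} (hM : IsModel M (catTheory D)) {a b c : C}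
    (f : a ⟶ c) (g : b ⟶ c)
    (hw : M.opMap (pullback.fst f g) ≫ M.opMap f = M.opMap (pullback.snd f g) ≫ M.opMap g) :
    IsPullback (M.opMap (pullback.fst f g)) (M.opMap (pullback.snd f g)) (M.opMap f)
      (M.opMap g) := by
  have hM' := hM
  rw [isModel_iff] at hM
  have hf {X : E} (x : M.Env X [a, b]) (y : X ⟶ M.sort (pullback f g)) :
      Forces (Str.Env.cons (S := catSig C) y x) (pullbackFormula f g) ↔
        y ≫ M.opMap (pullback.fst f g) = x (0 : Fin 2) ∧
          y ≫ M.opMap (pullback.snd f g) = x (1 : Fin 2) := by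
    change (Term.eval _ _ = Term.eval _ _ ∧ Term.eval _ _ = Term.eval _ _) ↔ _
    rw [eval_mapTerm, eval_mapTerm]
    rfl
  have hu : UniqueWitness M (pullbackFormula f g) :=
    (provablyUnique_of_mem (CatAx.pullbackUniq f g)).uniqueWitness hM'
  have key {X : E} (p : X ⟶ M.sort a) (q : X ⟶ M.sort b)
      (h : p ≫ M.opMap f = q ≫ M.opMap g) : ∃ y : X ⟶ M.sort (pullback f g),
        y ≫ M.opMap (pullback.fst f g) = p ∧ y ≫ M.opMap (pullback.snd f g) = q := by
    let x : M.Env X [a, b] := (Str.Env.cons (S := catSig C) (s := b) q (Str.Env.nil M X)).cons p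
    have := hM _ (CatAx.pullback f g) x (by
      change Term.eval _ _ = Term.eval _ _
      rw [eval_mapTerm, eval_mapTerm]
      exact h)
    rw [forces_ex_iff hu] at this
    obtain ⟨y, hy⟩ := this
    exact ⟨y, (hf _ _).1 hy⟩
  refine ⟨⟨hw⟩, ⟨PullbackCone.IsLimit.mk _ (fun s => (key s.fst s.snd s.condition).choose)
    (fun s => (key s.fst s.snd s.condition).choose_spec.1)
    (fun s => (key s.fst s.snd s.condition).choose_spec.2) fun s m h1 h2 => ?_⟩⟩
  let x : M.Env s.pt [a, b] :=
    (Str.Env.cons (S := catSig C) (s := b) s.snd (Str.Env.nil M s.pt)).cons s.fst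
  exact hu x _ _ ((hf x _).2 ⟨h1, h2⟩) ((hf x _).2 (key s.fst s.snd s.condition).choose_spec)

/-- Each axiom is evaluated at a generic element, the identity of a sort, to give functoriality and
vanishing. Terminal object and pullbacks suffice for left exactness. -/
lemma exists_functor_of_isModel (M : Str (catSig C) E) (hM : IsModel M (catTheory D)) :
    ∃ N : C ⥤ E, PreservesFiniteLimits N ∧ (∀ c, ¬ D c → Nonempty (IsInitial (N.obj c))) ∧
      strOf N = M := by
  have hM' := hM
  rw [isModel_iff] at hM
  let N : C ⥤ E :=
    { obj c := M.sort c
      map f := M.opMap f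
      map_id c := by
        have := hM _ (CatAx.id c) ((Str.Env.nil M (M.sort c)).cons (s := c) (𝟙 (M.sort c))) trivial
        change Term.eval _ _ = Term.eval _ _ at this
        rw [eval_mapTerm] at this
        exact (Category.id_comp _).symm.trans this
      map_comp {c d e} f g := by
        have := hM _ (CatAx.comp f g)
          ((Str.Env.nil M (M.sort c)).cons (s := c) (𝟙 (M.sort c))) trivial
        change Term.eval _ _ = Term.eval _ _ at this
        rw [eval_mapTerm, eval_mapTerm, eval_mapTerm] at this
        refine (Category.id_comp _).symm.trans (this.trans ?_)
        exact congrArg (· ≫ M.opMap g) (Category.id_comp _) }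
  -- The sorts agree definitionally, and an operation is recovered from its action through the
  -- one-fold product, so the equality is strict.
  have hN : strOf N = M := by
    have : ∀ f, (strOf N).op f = M.op f := fun f => (op_eq_opMap M f).symm
    obtain ⟨sort, op⟩ := M
    exact congrArg (Str.mk sort) (funext this)
  refine ⟨N, ?_, ?_, hN⟩
  · have : PreservesLimitsOfShape (Discrete PEmpty.{1}) N := by
      have hu : UniqueWitness M (.top : Formula (catSig C) ((⊤_ C : C) :: [])) :=
        (provablyUnique_of_mem CatAx.terminalUniq).uniqueWitness hM'
      have ht (X : E) : ∃! _ : X ⟶ N.obj (⊤_ C), True := by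
        obtain ⟨y, -⟩ := (forces_ex_iff hu (Str.Env.nil M X)).1
          (hM _ CatAx.terminal (Str.Env.nil M X) trivial)
        exact ⟨y, trivial, fun y' _ => hu (Str.Env.nil M X) _ _ trivial trivial⟩
      have : IsTerminal (N.obj (⊤_ C)) :=
        IsTerminal.ofUniqueHom (fun X => (ht X).choose) fun X m => (ht X).unique trivial trivial
      have := preservesTerminal_of_iso N (this.uniqueUpToIso terminalIsTerminal)
      exact preservesLimitsOfShape_pempty_of_preservesTerminal N
    have hpb : PreservesLimitsOfShape WalkingCospan N := by
      have (K : WalkingCospan ⥤ C) : PreservesLimit K N := by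
        have : PreservesLimit (cospan (K.map WalkingCospan.Hom.inl) (K.map WalkingCospan.Hom.inr))
            N := by
          generalize K.map WalkingCospan.Hom.inl = f
          generalize K.map WalkingCospan.Hom.inr = g
          refine preservesLimit_of_preserves_limit_cone (pullbackIsPullback f g)
            ((isLimitMapConePullbackConeEquiv N pullback.condition).symm ?_)
          have hN' {c d : C} (f : c ⟶ d) : N.map f = M.opMap f := rfl
          exact (isPullback_opMap hM' f g (by
            rw [← hN', ← hN', ← hN', ← hN', ← N.map_comp, ← N.map_comp, pullback.condition])).isLimit
        exact preservesLimit_of_iso_diagram N (diagramIsoCospan K).symm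
      exact ⟨fun {K} => this K⟩
    exact preservesFiniteLimits_of_preservesTerminal_and_pullbacks N
  · intro c hc
    exact hM _ (CatAx.empty c hc) ((Str.Env.nil M (M.sort c)).cons (s := c) (𝟙 (M.sort c))) trivial

end CatTheory

/-! ### Presheaves on a cosieve classify the theory -/

section Classifying

variable {C : Type u} [SmallCategory C] {E F : Topos.{u}}

lemma op_pull_strOf (N : C ⥤ E) (g : F ⟶ E) (f : (catSig C).Op) :
    ((strOf N).pull g).op f = (strOf (N ⋙ GeomMor.inverse g)).op f := by
  change (PreservesProduct.iso (GeomMor.inverse g)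
    (fun i : Fin [f.1].length => N.obj ([f.1].get i))).inv ≫
      (GeomMor.inverse g).map (Pi.π (fun i : Fin [f.1].length => N.obj ([f.1].get i)) (0 : Fin 1) ≫
        N.map f.2.2) = _
  refine (Iso.inv_comp_eq _).2 ?_
  refine ((GeomMor.inverse g).map_comp _ _).trans ?_
  refine Eq.trans ?_ (Category.assoc _ _ _)
  refine congrArg (· ≫ (GeomMor.inverse g).map (N.map f.2.2)) ?_
  exact (piComparison_comp_π (GeomMor.inverse g)
    (fun i : Fin [f.1].length => N.obj ([f.1].get i)) (0 : Fin 1)).symm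

lemma pull_strOf (N : C ⥤ E) (g : F ⟶ E) :
    (strOf N).pull g = strOf (N ⋙ GeomMor.inverse g) :=
  congrArg (Str.mk _) (funext fun f => op_pull_strOf N g f)

lemma opMap_pull_strOf (N : C ⥤ E) (g : F ⟶ E) {c d : C} (f : c ⟶ d) :
    ((strOf N).pull g).opMap f = (GeomMor.inverse g).map (N.map f) :=
  (congrArg (_ ≫ ·) (op_pull_strOf N g ⟨c, d, f⟩)).trans (opMap_strOf (N ⋙ GeomMor.inverse g) f)

/-- Natural transformations between restrictions to a cosieve extend if the source vanishes off the
cosieve. -/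
lemma exists_extend {A : Type*} [Category* A] {D : ObjectProperty C} (hD : IsCosieve D)
    {M M' : C ⥤ A} (hM : ∀ c, ¬ D c → Nonempty (IsInitial (M.obj c)))
    (γ : D.ι ⋙ M ⟶ D.ι ⋙ M') : ∃ γ' : M ⟶ M', ∀ d : D.FullSubcategory, γ'.app d.obj = γ.app d := by
  classical
  refine ⟨{ app := fun c => if h : D c then γ.app ⟨c, h⟩ else (hM c h).some.to _,
            naturality := fun c d f => ?_ }, fun d => dif_pos d.property⟩
  by_cases h : D c
  · have h' : D d := hD h f
    rw [dif_pos h, dif_pos h']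
    exact γ.naturality (X := ⟨c, h⟩) (Y := ⟨d, h'⟩) (ObjectProperty.homMk f)
  · exact (hM c h).some.hom_ext _ _

lemma extend_ext {A : Type*} [Category* A] {D : ObjectProperty C}
    {M M' : C ⥤ A} (hM : ∀ c, ¬ D c → Nonempty (IsInitial (M.obj c)))
    {α β : M ⟶ M'} (h : ∀ d : D.FullSubcategory, α.app d.obj = β.app d.obj) : α = β := by
  ext c
  by_cases hc : D c
  · exact h ⟨c, hc⟩
  · exact (hM c hc).some.hom_ext _ _

lemma exists_extend_iso {A : Type*} [Category* A] {D : ObjectProperty C} (hD : IsCosieve D)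
    {M M' : C ⥤ A} (hM : ∀ c, ¬ D c → Nonempty (IsInitial (M.obj c)))
    (hM' : ∀ c, ¬ D c → Nonempty (IsInitial (M'.obj c)))
    (γ : D.ι ⋙ M ≅ D.ι ⋙ M') : Nonempty (M ≅ M') := by
  obtain ⟨a, ha⟩ := exists_extend hD hM γ.hom
  obtain ⟨b, hb⟩ := exists_extend hD hM' γ.inv
  exact ⟨⟨a, b, extend_ext hM fun d => by simp [ha, hb],
    extend_ext hM' fun d => by simp [ha, hb]⟩⟩

/-- Isomorphic functors give isomorphic structures. -/
noncomputable def strOfIso {N N' : C ⥤ E} (e : N ≅ N') : strOf N ≅ strOf N' where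
  hom := strOfMap e.hom
  inv := strOfMap e.inv
  hom_inv_id := Str.hom_ext fun c => e.hom_inv_id_app c
  inv_hom_id := Str.hom_ext fun c => e.inv_hom_id_app c

lemma CosievePres.isInitial_inverse {Z : Topos.{u}} (P : CosievePres Z) (g : F ⟶ Z) (c : P.C)
    (hc : ¬ P.D c) : Nonempty (IsInitial ((P.incl ⋙ GeomMor.inverse g).obj c)) := by
  obtain ⟨h⟩ := P.initial c hc
  exact ⟨(GeomMor.adj g).isInitialObj h⟩

/-- A homomorphism between inverse images is a natural family on `C`: over `D` it extends by
density, and off `D` it starts at an initial object, so there is no choice. A model is a left exact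
functor, which `P.lift` realizes over `D` and hence everywhere. -/
lemma CosievePres.isClassifying {Z : Topos.{u}} (P : CosievePres Z) :
    IsClassifying (catTheory P.D) Z := by
  refine ⟨strOf P.incl, fun F => ⟨⟨fun {f g} φ => ?_⟩, ⟨fun {f g} α β h => ?_⟩, fun M => ?_⟩⟩
  · let γ : (P.D.ι ⋙ P.incl) ⋙ GeomMor.inverse f ⟶ (P.D.ι ⋙ P.incl) ⋙ GeomMor.inverse g :=
      { app d := Str.Hom.map φ d.obj
        naturality c d k := by
          have := opMap_comm φ k.hom
          erw [opMap_pull_strOf, opMap_pull_strOf] at this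
          exact this }
    obtain ⟨α, hα⟩ := leftAdjoint_exists (v := P.D.ι ⋙ P.incl) (GeomMor.adj f) γ
    refine ⟨GeomMor.Hom₂.mk α, Str.hom_ext fun c => ?_⟩
    by_cases hc : P.D c
    · exact hα ⟨c, hc⟩
    · exact (P.isInitial_inverse f c hc).some.hom_ext _ _
  · refine GeomMor.Hom₂.ext ?_
    refine leftAdjoint_ext (v := P.D.ι ⋙ P.incl) (GeomMor.adj f) fun d => ?_
    exact congrFun (congrArg Str.Hom.map h) d.obj
  · constructor
    · intro hM
      obtain ⟨N, _, hN, rfl⟩ := exists_functor_of_isModel M hM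
      obtain ⟨g, ⟨e⟩⟩ := P.lift F N hN
      obtain ⟨e'⟩ := exists_extend_iso P.isCosieve (P.isInitial_inverse g) hN e
      exact ⟨g, ⟨eqToIso (pull_strOf P.incl g) ≪≫ strOfIso e'⟩⟩
    · rintro ⟨g, ⟨e⟩⟩
      have : IsModel ((strOf P.incl).pull g) (catTheory P.D) := by
        rw [pull_strOf]
        exact isModel_strOf _ (P.isInitial_inverse g)
      exact this.of_iso e

lemma exists_isClassifying_of_isPshOfCosieve {Z : Topos.{u}} (hZ : IsPshOfCosieve Z) :
    ∃ (S : Signature.{u}) (T : Theory S), IsEssAlgWithFalsum T ∧ IsClassifying T Z := by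
  obtain ⟨P⟩ := nonempty_cosievePres hZ
  exact ⟨_, _, isEssAlgWithFalsum_catTheory P.D, P.isClassifying⟩

end Classifying

/-! ### Finite limit hulls and the associated dominant morphism -/

section Hull

/-- The shapes of the limits which generate all finite limits. -/
def hullShape : Bool → Type
  | true => WalkingCospan
  | false => Discrete PEmpty.{1}

instance : ∀ b, SmallCategory (hullShape b)
  | true => inferInstanceAs (SmallCategory WalkingCospan)
  | false => inferInstanceAs (SmallCategory (Discrete PEmpty.{1}))

/-- A small full subcategory, closed under finite limits and generated under them by a small family
of objects. -/
lemma exists_lexHull {Z : Topos.{u}} {I : Type u} (X : I → Z) :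
    ∃ (C : Type u) (_ : SmallCategory C) (_ : HasFiniteLimits C) (ι : C ⥤ Z),
      PreservesFiniteLimits ι ∧ ι.Full ∧ ι.Faithful ∧ (∀ i, ∃ c, Nonempty (ι.obj c ≅ X i)) ∧
      ∀ (Q : ObjectProperty Z) [Q.IsClosedUnderIsomorphisms]
        [Q.IsClosedUnderLimitsOfShape WalkingCospan]
        [Q.IsClosedUnderLimitsOfShape (Discrete PEmpty.{1})],
        (∀ i, Q (X i)) → ∀ c, Q (ι.obj c) := by
  let P : ObjectProperty Z := (ObjectProperty.ofObj X).limitsClosure hullShape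
  have : P.IsClosedUnderLimitsOfShape WalkingCospan :=
    inferInstanceAs (P.IsClosedUnderLimitsOfShape (hullShape true))
  have : P.IsClosedUnderLimitsOfShape (Discrete PEmpty.{1}) :=
    inferInstanceAs (P.IsClosedUnderLimitsOfShape (hullShape false))
  have : ObjectProperty.EssentiallySmall.{u} P := inferInstance
  have : EssentiallySmall.{u} P.FullSubcategory := inferInstance
  have : HasPullbacks P.FullSubcategory := inferInstance
  have : HasTerminal P.FullSubcategory := inferInstanceAs (HasLimitsOfShape _ _)
  have : HasFiniteLimits P.FullSubcategory := hasFiniteLimits_of_hasTerminal_and_pullbacks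
  have : PreservesLimitsOfShape (Discrete PEmpty.{1}) P.ι := inferInstance
  have : PreservesLimitsOfShape WalkingCospan P.ι := inferInstance
  have : PreservesFiniteLimits P.ι := preservesFiniteLimits_of_preservesTerminal_and_pullbacks P.ι
  let e := equivSmallModel.{u} P.FullSubcategory
  have : HasFiniteLimits (SmallModel.{u} P.FullSubcategory) :=
    ⟨fun J _ _ => Adjunction.hasLimitsOfShape_of_equivalence e.inverse⟩
  refine ⟨SmallModel.{u} P.FullSubcategory, inferInstance, this, e.inverse ⋙ P.ι,
    comp_preservesFiniteLimits _ _, inferInstance, inferInstance, fun i => ?_, ?_⟩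
  · exact ⟨e.functor.obj ⟨X i, .of_mem _ ⟨i⟩⟩, ⟨P.ι.mapIso (e.unitIso.symm.app _)⟩⟩
  · intro Q _ _ _ hQ c
    have (b : Bool) : Q.IsClosedUnderLimitsOfShape (hullShape b) := by
      cases b
      · exact inferInstanceAs (Q.IsClosedUnderLimitsOfShape (Discrete PEmpty.{1}))
      · exact inferInstanceAs (Q.IsClosedUnderLimitsOfShape WalkingCospan)
    have h : P ≤ Q := ObjectProperty.limitsClosure_le (by
      rintro _ ⟨i⟩
      exact hQ i)
    exact h _ (e.inverse.obj c).property

/-- The objects at which a natural transformation is invertible are closed under limits preserved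
by both functors. -/
lemma isIso_app_closed {A B : Type*} [Category* A] [Category* B] {F G : A ⥤ B} (θ : F ⟶ G)
    (J : Type*) [Category* J] [PreservesLimitsOfShape J F] [PreservesLimitsOfShape J G] :
    ObjectProperty.IsClosedUnderLimitsOfShape (fun A => IsIso (θ.app A)) J where
  limitsOfShape_le := by
    rintro X ⟨hX⟩
    let p := hX.toLimitPresentation
    have (j : J) : IsIso (θ.app (p.diag.obj j)) := hX.prop_diag_obj j
    have : IsIso (Functor.whiskerLeft p.diag θ) := by
      have (j : J) : IsIso ((Functor.whiskerLeft p.diag θ).app j) :=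
        inferInstanceAs (IsIso (θ.app (p.diag.obj j)))
      exact NatIso.isIso_of_isIso_app _
    have hF := isLimitOfPreserves F p.isLimit
    have hG := isLimitOfPreserves G p.isLimit
    have h : θ.app X = (IsLimit.conePointsIsoOfNatIso hF hG
        (asIso (Functor.whiskerLeft p.diag θ))).hom := by
      refine hG.hom_ext fun j => ?_
      refine Eq.trans ?_ (IsLimit.conePointsIsoOfNatIso_hom_comp hF hG _ j).symm
      exact (θ.naturality _).symm
    change IsIso (θ.app X)
    rw [h]
    infer_instance

/-- The restricted Yoneda functor of a fully faithful functor restricts to the Yoneda embedding. -/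
noncomputable def yonedaNerveIso {A Z : Type*} [Category.{u} A] [Category.{u} Z] (w : A ⥤ Z) [w.Full]
    [w.Faithful] : uliftYoneda.{u} ≅ w ⋙ restrictedULiftYoneda.{u} w :=
  NatIso.ofComponents (fun a => NatIso.ofComponents
    (fun b => (Equiv.ulift.trans ((Functor.FullyFaithful.ofFullyFaithful w).homEquiv.trans
      Equiv.ulift.symm)).toIso) (fun f => by
        ext x
        exact congrArg ULift.up (w.map_comp _ _))) (fun f => by
          ext b x
          exact congrArg ULift.up (w.map_comp _ _))

/-- The counit of a nerve adjunction is invertible at the image of the given functor, if that is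
fully faithful. -/
lemma isIso_counit_of_nerve {A : Type u} [SmallCategory A] {Z : Type*} [Category.{u} Z]
    (w : A ⥤ Z) [w.Full] [w.Faithful] {L : (Aᵒᵖ ⥤ Type u) ⥤ Z}
    (adj : L ⊣ restrictedULiftYoneda.{u} w) (a : A) : IsIso (adj.counit.app (w.obj a)) := by
  have h (B : Z) : Function.Bijective
      (fun f : w.obj a ⟶ B => (restrictedULiftYoneda.{u} w).map f) := by
    -- By Yoneda, maps from the nerve of `w a` to that of `B` are maps `w a ⟶ B`; under this
    -- identification the action of the nerve functor is the identity.
    let e := ((((yonedaNerveIso w).app a).homFromEquiv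
      (Z := (restrictedULiftYoneda.{u} w).obj B)).symm.trans uliftYonedaEquiv).trans Equiv.ulift
    refine (Equiv.comp_bijective _ e).1 ?_
    convert Function.bijective_id using 1
    funext f
    change w.map (𝟙 a) ≫ f = f
    rw [w.map_id, Category.id_comp]
  -- The adjunct of the counit followed by `f` is the nerve of `f`, so precomposition with the
  -- counit is bijective, which forces it to be invertible.
  have h' (B : Z) : Function.Bijective (fun f : w.obj a ⟶ B => adj.counit.app (w.obj a) ≫ f) := by
    refine (Equiv.comp_bijective _ (adj.homEquiv _ _)).1 ?_
    convert h B using 1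
    funext f
    simp [Adjunction.homEquiv_unit]
  obtain ⟨g, hg⟩ := (h' _).2 (𝟙 _)
  refine ⟨g, hg, (h' _).1 ?_⟩
  change adj.counit.app (w.obj a) ≫ g ≫ adj.counit.app (w.obj a) = _ ≫ 𝟙 _
  change adj.counit.app (w.obj a) ≫ g = _ at hg
  rw [← Category.assoc, hg, Category.id_comp, Category.comp_id]

variable {C : Type u} [SmallCategory C] {Z : Topos.{u}} (ι : C ⥤ Z)

/-- The objects whose image is not initial. -/
def noninitial : ObjectProperty C := fun c => IsEmpty (IsInitial (ι.obj c))

lemma isCosieve_noninitial : IsCosieve (noninitial ι) :=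
  fun _ _ h f => ⟨fun hc => h.false (IsInitial.ofStrict (ι.map f) hc)⟩

lemma isInitial_of_not_noninitial (c : C) (hc : ¬ noninitial ι c) :
    Nonempty (IsInitial (ι.obj c)) :=
  not_isEmpty_iff.1 hc

variable [HasFiniteLimits C] [PreservesFiniteLimits ι]

/-- The geometric morphism to presheaves on the objects with noninitial image. -/
noncomputable abbrev hullMor : Z ⟶ pshTopos (noninitial ι).FullSubcategory :=
  nerveMor (isCosieve_noninitial ι) ι (isInitial_of_not_noninitial ι)

/-- The nerve of the initial object consists of maps from noninitial objects to it, and strictness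
rules these out. This is why initial objects are discarded from the hull. -/
lemma isDominant_hullMor : IsDominant (hullMor ι) := by
  have h : IsInitial ((GeomMor.direct (hullMor ι)).obj (⊥_ Z)) := by
    refine IsInitial.ofUniqueHom (fun Y => ?_) fun Y m => ?_
    · exact { app := fun d => ↾fun x => (d.unop.property.false
                (IsInitial.ofStrict x.down initialIsInitial)).elim
              naturality := fun d _ _ => by
                ext x
                exact (d.unop.property.false (IsInitial.ofStrict x.down initialIsInitial)).elim }
    · ext d x
      exact (d.unop.property.false (IsInitial.ofStrict (X := ι.obj d.unop.obj) x.down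
        initialIsInitial)).elim
  have := preservesInitial_of_iso (GeomMor.direct (hullMor ι)) (initialIsInitial.uniqueUpToIso h)
  exact preservesColimitsOfShape_pempty_of_preservesInitial _

/-- On noninitial objects this is the counit of a nerve at an object of the site. On initial ones
both sides are initial, by dominance. -/
lemma isIso_counit_hullMor [ι.Full] [ι.Faithful] (c : C) :
    IsIso ((GeomMor.adj (hullMor ι)).counit.app (ι.obj c)) := by
  by_cases hc : noninitial ι c
  · exact isIso_counit_of_nerve ((noninitial ι).ι ⋙ ι) (GeomMor.adj (hullMor ι)) ⟨c, hc⟩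
  · obtain ⟨h⟩ := isInitial_of_not_noninitial ι c hc
    have : PreservesColimitsOfShape (Discrete PEmpty.{1}) (GeomMor.direct (hullMor ι)) :=
      isDominant_hullMor ι
    have h' := (GeomMor.adj (hullMor ι)).isInitialObj
      (h.isInitialObj (GeomMor.direct (hullMor ι)))
    exact ⟨h.to _, h'.hom_ext _ _, h.hom_ext _ _⟩

end Hull

/-! ### From a classifying topos to presheaves on a cosieve -/

section Presentation

variable {S : Signature.{u}} {Z F : Topos.{u}}

lemma Str.isIso_of_components {M N : Str S Z} (α : M ⟶ N) (h : ∀ s, IsIso (Str.Hom.map α s)) :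
    IsIso α := by
  refine ⟨Str.Hom.mk (fun s => inv (Str.Hom.map α s)) fun o => ?_,
    Str.hom_ext fun s => IsIso.hom_inv_id _, Str.hom_ext fun s => IsIso.inv_hom_id _⟩
  rw [IsIso.eq_comp_inv, Category.assoc, ← Str.Hom.comm α o, ← Category.assoc]
  refine (congrArg (· ≫ N.op o) ?_).trans (Category.id_comp _)
  ext i
  simp

lemma map_id_comp_eq {A : Type*} [Category* A] {n : ℕ} (X : Fin n → A) [HasProduct X]
    [PreservesLimit (Discrete.functor X) (𝟭 A)] [HasProduct fun k => (𝟭 A).obj (X k)] {Y : A}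
    (v : ∏ᶜ X ⟶ Y) :
    Limits.Pi.map (fun k => 𝟙 (X k)) ≫ v =
      ((PreservesProduct.iso (𝟭 A) X).inv ≫ (𝟭 A).map v) ≫ 𝟙 Y := by
  have : Limits.Pi.map (fun k => 𝟙 (X k)) = (PreservesProduct.iso (𝟭 A) X).inv := by
    refine (Iso.eq_inv_comp _).2 ?_ |>.trans (Category.comp_id _)
    refine Limits.Pi.hom_ext _ _ fun k => ?_
    refine (Category.assoc _ _ _).trans ((congrArg (_ ≫ ·) (Pi.map_π _ k)).trans ?_)
    refine (congrArg (_ ≫ ·) (Category.comp_id _)).trans ?_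
    exact (piComparison_comp_π (𝟭 A) X k).trans (Category.id_comp _).symm
  rw [this]
  exact (Category.comp_id _).symm

/-- Makes `transposeHom` a homomorphism. Naturality of the adjunction bijection carries `h` across;
what remains is a compatibility of product comparisons, checked on projections. -/
lemma map_homEquiv_symm_comp {A B : Type*} [Category* A] [Category* B] [HasFiniteProducts A]
    [HasFiniteProducts B] {L : B ⥤ A} {R : A ⥤ B} (adj : L ⊣ R) (P : A ⥤ B)
    {n : ℕ} [PreservesLimitsOfShape (Discrete (Fin n)) P]
    [PreservesLimitsOfShape (Discrete (Fin n)) R]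
    [PreservesLimitsOfShape (Discrete (Fin n)) (P ⋙ L)] {X : Fin n → A} {Y : A} (v : ∏ᶜ X ⟶ Y)
    (φ : ∀ k, P.obj (X k) ⟶ R.obj (X k)) (ψ : P.obj Y ⟶ R.obj Y)
    (h : Limits.Pi.map φ ≫ (PreservesProduct.iso R X).inv ≫ R.map v =
      ((PreservesProduct.iso P X).inv ≫ P.map v) ≫ ψ) :
    Limits.Pi.map (fun k => (adj.homEquiv _ _).symm (φ k)) ≫ v =
      ((PreservesProduct.iso (P ⋙ L) X).inv ≫ L.map (P.map v)) ≫ (adj.homEquiv _ _).symm ψ := by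
  have h1 : P.map v ≫ ψ = ((PreservesProduct.iso P X).hom ≫ Limits.Pi.map φ ≫
      (PreservesProduct.iso R X).inv) ≫ R.map v := by
    rw [Category.assoc, Category.assoc, h, Category.assoc, Iso.hom_inv_id_assoc]
  rw [Category.assoc, Iso.eq_inv_comp, ← adj.homEquiv_naturality_left_symm, h1,
    adj.homEquiv_naturality_right_symm, ← Category.assoc]
  congr 1
  refine Limits.Pi.hom_ext _ _ fun k => ?_
  rw [← adj.homEquiv_naturality_right_symm]
  have h2 : ((PreservesProduct.iso P X).hom ≫ Limits.Pi.map φ ≫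
      (PreservesProduct.iso R X).inv) ≫ R.map (Pi.π X k) = P.map (Pi.π X k) ≫ φ k := by
    have h3 : (PreservesProduct.iso R X).inv ≫ R.map (Pi.π X k) = Pi.π _ k := by
      rw [Iso.inv_comp_eq]
      simp
    rw [Category.assoc, Category.assoc, h3]
    simp
  rw [h2, adj.homEquiv_naturality_left_symm, Category.assoc, Pi.map_π, ← Category.assoc]
  exact congrArg (· ≫ (adj.homEquiv _ _).symm (φ k)) (piComparison_comp_π (P ⋙ L) X k)

/-- The structure `U` is its own inverse image under the identity. -/
lemma exists_pull_id_iso (U : Str S Z) : ∃ e : U.pull (𝟙 Z) ≅ U, ∀ s, Str.Hom.map e.hom s = 𝟙 _ := by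
  let α : U.pull (𝟙 Z) ⟶ U := Str.Hom.mk (fun s => 𝟙 (U.sort s)) fun o =>
    map_id_comp_eq _ (U.op o)
  have : IsIso α := Str.isIso_of_components α fun s => IsIso.id (U.sort s)
  exact ⟨asIso α, fun s => rfl⟩

/-- The transpose of a homomorphism from an inverse image to a direct image. -/
noncomputable def transposeHom {U : Str S Z} {i : Z ⟶ F} {p : F ⟶ Z} (φ : U.pull p ⟶ U.push i) :
    U.pull (i ≫ p) ⟶ U :=
  Str.Hom.mk
    (fun s => ((GeomMor.adj i).homEquiv _ (U.sort s)).symm (Str.Hom.map φ s)) fun o =>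
      map_homEquiv_symm_comp (GeomMor.adj i) (GeomMor.inverse p) (U.op o) _ _ (Str.Hom.comm φ o)

lemma isIso_homEquiv_symm {A B : Type*} [Category* A] [Category* B] {L : B ⥤ A} {R : A ⥤ B}
    (adj : L ⊣ R) {X : B} {Y : A} (f : X ⟶ R.obj Y) (hf : IsIso f)
    (hY : IsIso (adj.counit.app Y)) : IsIso ((adj.homEquiv X Y).symm f) := by
  rw [Adjunction.homEquiv_counit]
  infer_instance

lemma isPshOfCosieve_of_isClassifying {T : Theory S} (hT : IsEssAlgWithFalsum T)
    (hZ : IsClassifying T Z) : IsPshOfCosieve Z := by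
  obtain ⟨U, hU⟩ := hZ
  obtain ⟨C, _, _, ι, _, _, _, hsort, hgen⟩ := exists_lexHull U.sort
  let D := noninitial ι
  let i := hullMor ι
  obtain ⟨eU, heU⟩ := exists_pull_id_iso U
  have hmod : IsModel U T := ((hU Z).2.2 U).2 ⟨𝟙 Z, ⟨eU⟩⟩
  have hpush : IsModel (U.push i) T := isModel_push (isDominant_hullMor ι) hT hmod
  obtain ⟨p, ⟨φ⟩⟩ := ((hU _).2.2 (U.push i)).1 hpush
  replace φ : U.pull p ≅ U.push i := φ
  have hφ (s) : IsIso (Str.Hom.map φ.hom s) :=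
    ⟨Str.Hom.map φ.inv s, congrArg (fun α => Str.Hom.map α s) φ.hom_inv_id,
      congrArg (fun α => Str.Hom.map α s) φ.inv_hom_id⟩
  have hcounit (s) : IsIso ((GeomMor.adj i).counit.app (U.sort s)) := by
    obtain ⟨c, ⟨e⟩⟩ := hsort s
    have := isIso_counit_hullMor ι c
    exact (NatTrans.isIso_app_iff_of_iso (GeomMor.adj i).counit e).1 this
  -- Each component is the inverse image of an isomorphism followed by the counit at a sort, and
  -- sorts lie in the hull.
  have htr : IsIso (transposeHom φ.hom) := Str.isIso_of_components _ fun s => by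
    exact isIso_homEquiv_symm (GeomMor.adj i) _ (hφ s) (hcounit s)
  have := (hU Z).1
  have := (hU Z).2.1
  -- Full faithfulness of `f ↦ f^* U` turns the isomorphism of structures into an invertible 2-cell.
  let χ : i ≫ p ≅ 𝟙 Z := (U.pullFunctor Z).preimageIso
    ((asIso (transposeHom φ.hom)).trans eU.symm)
  have hχ (s) : (GeomMor.nat χ.hom).app (U.sort s) =
      ((GeomMor.adj i).homEquiv _ (U.sort s)).symm (Str.Hom.map φ.hom s) := by
    have h1 : (U.pullFunctor Z).map χ.hom = transposeHom φ.hom ≫ eU.inv :=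
      (U.pullFunctor Z).map_preimage _
    have h2 : (U.pullFunctor Z).map χ.hom ≫ eU.hom = transposeHom φ.hom := by
      rw [h1]
      exact (Category.assoc _ _ _).trans ((congrArg (_ ≫ ·) eU.inv_hom_id).trans
        (Category.comp_id _))
    have h3 : (GeomMor.nat χ.hom).app (U.sort s) ≫ Str.Hom.map eU.hom s =
        ((GeomMor.adj i).homEquiv _ (U.sort s)).symm (Str.Hom.map φ.hom s) :=
      congrArg (fun α => Str.Hom.map α s) h2
    rw [heU s] at h3
    exact (Category.comp_id _).symm.trans h3
  let e₁ : GeomMor.inverse p ⋙ GeomMor.inverse i ≅ 𝟭 Z :=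
    ⟨GeomMor.nat χ.hom, GeomMor.nat χ.inv, congrArg GeomMor.nat χ.hom_inv_id,
      congrArg GeomMor.nat χ.inv_hom_id⟩
  let θ : GeomMor.inverse p ⟶ GeomMor.direct i :=
    { app A := (GeomMor.adj i).homEquiv _ A (e₁.hom.app A)
      naturality A B f := by
        rw [← (GeomMor.adj i).homEquiv_naturality_left, ← (GeomMor.adj i).homEquiv_naturality_right]
        exact congrArg _ (e₁.hom.naturality f) }
  -- The objects where `θ` is invertible are closed under finite limits, both functors being left
  -- exact, and contain the sorts, where `θ` transposes back to `φ`.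
  have hθ (c : C) : IsIso (θ.app (ι.obj c)) := by
    have : ObjectProperty.IsClosedUnderIsomorphisms (fun A => IsIso (θ.app A)) :=
      ⟨fun e h => (NatTrans.isIso_app_iff_of_iso θ e).1 h⟩
    have : PreservesFiniteLimits (GeomMor.inverse p) := GeomMor.lex p
    have : PreservesFiniteLimits (GeomMor.direct i) := preservesFiniteLimits_direct i
    have := isIso_app_closed θ WalkingCospan
    have := isIso_app_closed θ (Discrete PEmpty.{1})
    refine hgen (fun A => IsIso (θ.app A)) (fun s => ?_) c
    have : θ.app (U.sort s) = Str.Hom.map φ.hom s := ((Equiv.eq_symm_apply _).1 (hχ s))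
    rw [this]
    exact hφ s
  let w := D.ι ⋙ ι
  have hw : IsIso (Functor.whiskerLeft w θ) := by
    have (d : D.FullSubcategory) : IsIso ((Functor.whiskerLeft w θ).app d) := hθ d.obj
    exact NatIso.isIso_of_isIso_app _
  have : PreservesColimitsOfSize.{u, u} (GeomMor.inverse i) :=
    (GeomMor.adj i).leftAdjoint_preservesColimits
  have : PreservesColimitsOfSize.{u, u} (GeomMor.inverse p) :=
    (GeomMor.adj p).leftAdjoint_preservesColimits
  -- On a representable `d`, `i^*` gives `w d`, then `p^* (w d) ≅ i_* (w d)` by `θ`, and the nerve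
  -- of `w d` is again the representable. Cocontinuity extends this to all presheaves.
  let e₂ : GeomMor.inverse i ⋙ GeomMor.inverse p ≅ 𝟭 (D.FullSubcategoryᵒᵖ ⥤ Type u) :=
    isoOfRepresentables _ _
      (Functor.isoWhiskerRight (isExtensionAlongULiftYoneda.{u} w) (GeomMor.inverse p) ≪≫
        asIso (Functor.whiskerLeft w θ) ≪≫ (yonedaNerveIso w).symm)
  exact ⟨C, _, inferInstance, D, isCosieve_noninitial ι,
    ⟨CategoryTheory.Equivalence.mk (GeomMor.inverse p) (GeomMor.inverse i) e₁.symm e₂⟩⟩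

end Presentation

/-! ### Unique lifting of transformations along a comparison -/

section Lifts

variable {A X Z Y F : Type*} [Category* A] [Category* X] [Category* Z] [Category* Y] [Category* F]

/-- Every natural transformation `H ⟶ Q ⋙ G` lifts uniquely along `κ : P ⟶ Q`. -/
def Lifts {P Q : Z ⥤ F} (κ : P ⟶ Q) (H : Z ⥤ Y) (G : F ⥤ Y) : Prop :=
  ∀ β : H ⟶ Q ⋙ G, ∃! α : H ⟶ P ⋙ G, α ≫ Functor.whiskerRight κ G = β

/-- Transformations out of the left adjoint `H` are determined freely on the dense part, and there
`κ` can be inverted. -/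
lemma lifts_of_dense {v : A ⥤ Z} [v.IsDense] {P Q : Z ⥤ F} (κ : P ⟶ Q)
    (hκ : ∀ a, IsIso (κ.app (v.obj a))) {H : Z ⥤ Y} {R : Y ⥤ Z} (adj : H ⊣ R) (G : F ⥤ Y) :
    Lifts κ H G := by
  intro β
  let γ : v ⋙ H ⟶ v ⋙ P ⋙ G :=
    { app a := β.app (v.obj a) ≫ G.map (inv (κ.app (v.obj a)))
      naturality a b f := by
        have h1 : P.map (v.map f) ≫ κ.app (v.obj b) = κ.app (v.obj a) ≫ Q.map (v.map f) :=
          κ.naturality _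
        have h2 : Q.map (v.map f) ≫ inv (κ.app (v.obj b)) =
            inv (κ.app (v.obj a)) ≫ P.map (v.map f) := by
          rw [IsIso.comp_inv_eq, Category.assoc, h1, IsIso.inv_hom_id_assoc]
        have h3 : H.map (v.map f) ≫ β.app (v.obj b) = β.app (v.obj a) ≫ G.map (Q.map (v.map f)) :=
          β.naturality _
        change H.map (v.map f) ≫ β.app (v.obj b) ≫ G.map _ =
          (β.app (v.obj a) ≫ G.map _) ≫ G.map (P.map (v.map f))
        rw [← Category.assoc, h3, Category.assoc, Category.assoc, ← G.map_comp, ← G.map_comp, h2] }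
  obtain ⟨α, hα⟩ := leftAdjoint_exists (v := v) adj γ
  refine ⟨α, leftAdjoint_ext (v := v) adj fun a => ?_, fun α' h' => ?_⟩
  · change α.app _ ≫ G.map (κ.app _) = _
    rw [hα]
    change (β.app (v.obj a) ≫ G.map (inv (κ.app (v.obj a)))) ≫ G.map (κ.app _) = _
    rw [Category.assoc, ← G.map_comp, IsIso.inv_hom_id, G.map_id]
    exact Category.comp_id _
  · refine leftAdjoint_ext (v := v) adj fun a => ?_
    have : α'.app (v.obj a) ≫ G.map (κ.app (v.obj a)) = β.app (v.obj a) :=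
      NatTrans.congr_app h' (v.obj a)
    rw [hα]
    change _ = β.app (v.obj a) ≫ G.map (inv (κ.app (v.obj a)))
    rw [← this, Category.assoc, ← G.map_comp, IsIso.hom_inv_id, G.map_id]
    exact (Category.comp_id _).symm

/-- The restriction of a transformation along a left adjoint with invertible unit. -/
noncomputable def restrictLift {r : X ⥤ Z} {s : Z ⥤ X} (a : r ⊣ s) [IsIso a.unit] {P : Z ⥤ F}
    {Q : X ⥤ F} (κ : P ⟶ s ⋙ Q) : r ⋙ P ⟶ Q where
  app A := κ.app (r.obj A) ≫ Q.map ((inv a.unit).app A)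
  naturality A B f := by
    have h1 : P.map (r.map f) ≫ κ.app (r.obj B) = κ.app (r.obj A) ≫ Q.map (s.map (r.map f)) :=
      κ.naturality _
    have h2 : s.map (r.map f) ≫ (inv a.unit).app B = (inv a.unit).app A ≫ f :=
      (inv a.unit).naturality f
    change P.map (r.map f) ≫ _ = _
    rw [← Category.assoc, h1, Category.assoc, ← Q.map_comp, h2, Q.map_comp, Category.assoc]

/-- Along `r ⊣ s`, transformations `H ⟶ r ⋙ K` correspond to transformations `s ⋙ H ⟶ K`; with the
unit invertible, the lifting problem over `X` becomes the one over `Z`. -/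
lemma lifts_restrictLift {r : X ⥤ Z} {s : Z ⥤ X} (a : r ⊣ s) [IsIso a.unit] {P : Z ⥤ F}
    {Q : X ⥤ F} (κ : P ⟶ s ⋙ Q) {H : X ⥤ Y} {G : F ⥤ Y} (h : Lifts κ (s ⋙ H) G) :
    Lifts (restrictLift a κ) H G := by
  intro β
  obtain ⟨α, hα, huniq⟩ := h (Functor.whiskerLeft s β)
  have hα' (B : Z) : α.app B ≫ G.map (κ.app B) = β.app (s.obj B) := NatTrans.congr_app hα B
  have hinv (A : X) : a.unit.app A ≫ (inv a.unit).app A = 𝟙 A :=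
    NatTrans.congr_app (IsIso.hom_inv_id a.unit) A
  have hinv' (B : Z) : (inv a.unit).app (s.obj B) = s.map (a.counit.app B) := by
    have h1 : (inv a.unit).app (s.obj B) ≫ a.unit.app (s.obj B) = 𝟙 _ := by
      rw [← NatTrans.comp_app, IsIso.inv_hom_id, NatTrans.id_app]
    have h2 := a.right_triangle_components B
    refine (Category.comp_id _).symm.trans ((congrArg (_ ≫ ·) h2.symm).trans ?_)
    refine (Category.assoc _ _ _).symm.trans ((congrArg (· ≫ s.map (a.counit.app B)) h1).trans ?_)
    exact Category.id_comp _
  refine ⟨{ app A := H.map (a.unit.app A) ≫ α.app (r.obj A), naturality := fun A B f => ?_ }, ?_,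
    fun α' h' => ?_⟩
  · have h1 : H.map (s.map (r.map f)) ≫ α.app (r.obj B) =
        α.app (r.obj A) ≫ G.map (P.map (r.map f)) := α.naturality _
    have h2 : f ≫ a.unit.app B = a.unit.app A ≫ s.map (r.map f) := a.unit.naturality f
    change _ = _ ≫ G.map (P.map (r.map f))
    rw [← Category.assoc, ← H.map_comp, h2, H.map_comp, Category.assoc, h1, Category.assoc]
  · ext A
    change (H.map (a.unit.app A) ≫ α.app (r.obj A)) ≫
      G.map (κ.app (r.obj A) ≫ Q.map ((inv a.unit).app A)) = β.app A
    have h1 : H.map ((inv a.unit).app A) ≫ β.app A =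
      β.app (s.obj (r.obj A)) ≫ G.map (Q.map ((inv a.unit).app A)) := β.naturality _
    rw [G.map_comp, Category.assoc, ← Category.assoc (α.app _), hα', ← h1, ← Category.assoc,
      ← H.map_comp, hinv]
    exact (congrArg (· ≫ β.app A) (H.map_id A)).trans (Category.id_comp _)
  · have h'' (A : X) : α'.app A ≫ G.map (κ.app (r.obj A) ≫ Q.map ((inv a.unit).app A)) =
        β.app A := NatTrans.congr_app h' A
    let α'' : s ⋙ H ⟶ P ⋙ G :=
      Functor.whiskerLeft s α' ≫ Functor.whiskerRight a.counit (P ⋙ G)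
    have h2 : α'' = α := huniq _ (by
      ext B
      change (α'.app (s.obj B) ≫ G.map (P.map (a.counit.app B))) ≫ G.map (κ.app B) =
        β.app (s.obj B)
      have h1 : P.map (a.counit.app B) ≫ κ.app B =
        κ.app (r.obj (s.obj B)) ≫ Q.map (s.map (a.counit.app B)) := κ.naturality _
      rw [Category.assoc, ← G.map_comp, h1, ← hinv', h''])
    ext A
    have h3 : H.map (a.unit.app A) ≫ α'.app (s.obj (r.obj A)) =
      α'.app A ≫ G.map (P.map (r.map (a.unit.app A))) := α'.naturality _
    have h4 : α.app (r.obj A) =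
        α'.app (s.obj (r.obj A)) ≫ G.map (P.map (a.counit.app (r.obj A))) :=
      NatTrans.congr_app h2.symm _
    change _ = H.map (a.unit.app A) ≫ α.app (r.obj A)
    rw [h4, ← Category.assoc, h3, Category.assoc, ← G.map_comp, ← P.map_comp,
      a.left_triangle_components]
    simp

lemma Lifts.of_iso_comp {P P' Q : Z ⥤ F} {κ' : P' ⟶ Q} (e : P ≅ P') {H : Z ⥤ Y} {G : F ⥤ Y}
    (h : Lifts (e.hom ≫ κ') H G) : Lifts κ' H G := by
  intro β
  obtain ⟨α, hα, huniq⟩ := h β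
  refine ⟨α ≫ Functor.whiskerRight e.hom G, ?_, fun α' h' => ?_⟩
  · change (α ≫ Functor.whiskerRight e.hom G) ≫ Functor.whiskerRight κ' G = β
    rw [Category.assoc, ← Functor.whiskerRight_comp, hα]
  · have : α' ≫ Functor.whiskerRight e.inv G = α := huniq _ (by
      change (α' ≫ Functor.whiskerRight e.inv G) ≫ Functor.whiskerRight (e.hom ≫ κ') G = β
      rw [Category.assoc, ← Functor.whiskerRight_comp, e.inv_hom_id_assoc, h'])
    rw [← this, Category.assoc, ← Functor.whiskerRight_comp, e.inv_hom_id]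
    simp

/-- Transformations out of a right adjoint are determined by their restriction along the unit. -/
lemma unit_ext {L : Z ⥤ F} {R : F ⥤ Z} (adj : L ⊣ R) {G : F ⥤ Z} {α α' : R ⟶ G}
    (h : ∀ A, adj.unit.app A ≫ α.app (L.obj A) = adj.unit.app A ≫ α'.app (L.obj A)) :
    α = α' := by
  have key (α : R ⟶ G) (B : F) :
      α.app B = (adj.unit.app (R.obj B) ≫ α.app (L.obj (R.obj B))) ≫ G.map (adj.counit.app B) := by
    rw [Category.assoc, ← α.naturality, adj.right_triangle_components_assoc]
    rfl
  ext B
  rw [key α, key α', h]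

/-- With `unit_ext`, a bijection between transformations `R ⟶ G` and `𝟭 Z ⟶ L ⋙ G`. -/
lemma unit_exists {L : Z ⥤ F} {R : F ⥤ Z} (adj : L ⊣ R) {G : F ⥤ Z} (δ : 𝟭 Z ⟶ L ⋙ G) :
    ∃ α : R ⟶ G, ∀ A, adj.unit.app A ≫ α.app (L.obj A) = δ.app A := by
  have hδ {A B : Z} (f : A ⟶ B) : f ≫ δ.app B = δ.app A ≫ G.map (L.map f) := δ.naturality f
  refine ⟨{ app B := δ.app (R.obj B) ≫ G.map (adj.counit.app B), naturality := fun B B' f => ?_ },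
    fun A => ?_⟩
  · rw [← Category.assoc, hδ, Category.assoc, Category.assoc, ← G.map_comp, ← G.map_comp]
    exact congrArg (_ ≫ G.map ·) (adj.counit.naturality f)
  · refine (Category.assoc _ _ _).symm.trans ?_
    refine (congrArg (· ≫ G.map (adj.counit.app (L.obj A))) (hδ (adj.unit.app A))).trans ?_
    refine (Category.assoc _ _ _).trans ((congrArg (_ ≫ ·) (G.map_comp _ _).symm).trans ?_)
    refine (congrArg (δ.app A ≫ G.map ·) (adj.left_triangle_components A)).trans ?_
    exact (congrArg (δ.app A ≫ ·) (G.map_id _)).trans (Category.comp_id _)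

lemma whiskerRight_homEquiv_app {L : Z ⥤ F} {R : F ⥤ Z} (adj : L ⊣ R) {P : A ⥤ Z} {Q : A ⥤ F}
    (γ : P ⋙ L ⟶ Q) (a : A) :
    ((adj.whiskerRight A).homEquiv P Q γ).app a = adj.unit.app (P.obj a) ≫ R.map (γ.app a) := by
  rw [Adjunction.homEquiv_unit]
  simp

end Lifts

/-! ### Kan extensions and pointwiseness through the transposed counit -/

section Extensions

variable {E F X : Topos.{u}} {f : E ⟶ F} {x : E ⟶ X}

/-- The transpose of the counit of a right extension. -/
noncomputable def transposeCounit (t : RightExtension f x) :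
    GeomMor.inverse t.extension ⟶ GeomMor.inverse x ⋙ GeomMor.direct f :=
  ((GeomMor.adj f).whiskerRight X).homEquiv (GeomMor.inverse t.extension) (GeomMor.inverse x)
    (GeomMor.nat t.counit)

/-- The right extension with a given transposed counit. -/
noncomputable def extensionMk (g : F ⟶ X)
    (κ : GeomMor.inverse g ⟶ GeomMor.inverse x ⋙ GeomMor.direct f) : RightExtension f x :=
  RightExtension.mk g (GeomMor.Hom₂.mk
    ((((GeomMor.adj f).whiskerRight X).homEquiv (GeomMor.inverse g) (GeomMor.inverse x)).symm κ))

lemma transposeCounit_extensionMk (g : F ⟶ X)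
    (κ : GeomMor.inverse g ⟶ GeomMor.inverse x ⋙ GeomMor.direct f) :
    transposeCounit (extensionMk g κ) = κ :=
  Equiv.apply_symm_apply _ _

lemma comp_transposeCounit_eq_iff (t s : RightExtension f x) (α : s.extension ⟶ t.extension) :
    GeomMor.nat α ≫ transposeCounit t = transposeCounit s ↔
      f ◁ α ≫ t.counit = s.counit := by
  let adj := (GeomMor.adj f).whiskerRight X
  have h : GeomMor.nat α ≫ transposeCounit t =
      adj.homEquiv _ _ (Functor.whiskerRight (GeomMor.nat α) (GeomMor.inverse f) ≫
        GeomMor.nat t.counit) := (adj.homEquiv_naturality_left _ _).symm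
  rw [h]
  refine ((adj.homEquiv _ _).apply_eq_iff_eq).trans ?_
  exact ⟨fun h => GeomMor.Hom₂.ext h, fun h => congrArg GeomMor.nat h⟩

/-- A competing extension by `g` is, after transposition, a transformation `g^* ⟶ x^* ⋙ f_*`, and
its factorizations through `t` are its lifts along the transposed counit. -/
lemma isKan_of_lifts (t : RightExtension f x)
    (h : ∀ g : F ⟶ X, Lifts (transposeCounit t) (GeomMor.inverse g) (𝟭 F)) :
    Nonempty t.IsKan := by
  have h' (s : RightExtension f x) : ∃! α : s.extension ⟶ t.extension,
      f ◁ α ≫ t.counit = s.counit := by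
    obtain ⟨α, hα, hu⟩ := h s.extension (transposeCounit s)
    refine ⟨GeomMor.Hom₂.mk α, ?_, fun α' h' => GeomMor.Hom₂.ext ?_⟩
    · exact (comp_transposeCounit_eq_iff t s (GeomMor.Hom₂.mk α)).1 hα
    · exact hu _ ((comp_transposeCounit_eq_iff t s α').2 h')
  exact ⟨IsTerminal.ofUniqueHom
    (fun s => RightExtension.homMk (h' s).choose (h' s).choose_spec.1) fun s τ =>
      CostructuredArrow.ext _ _ ((h' s).choose_spec.2 _ (RightExtension.w τ))⟩

lemma unit_comp_mate (t : RightExtension f x) (A : X) :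
    (GeomMor.adj x).unit.app A ≫ (mate t).app ((GeomMor.inverse x).obj A) =
      (GeomMor.adj t.extension).unit.app A ≫
        (GeomMor.direct t.extension).map ((transposeCounit t).app A) := by
  refine (unit_conjugateEquiv (GeomMor.adj x) (GeomMor.adj (f ≫ t.extension))
    (GeomMor.nat t.counit) A).trans ?_
  have h1 : (transposeCounit t).app A =
      (GeomMor.adj f).unit.app ((GeomMor.inverse t.extension).obj A) ≫
        (GeomMor.direct f).map ((GeomMor.nat t.counit).app A) :=
    whiskerRight_homEquiv_app _ _ _
  rw [h1, Functor.map_comp, ← Category.assoc]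
  exact congrArg (· ≫ (GeomMor.direct (f ≫ t.extension)).map ((GeomMor.nat t.counit).app A))
    (Adjunction.comp_unit_app (GeomMor.adj t.extension) (GeomMor.adj f) A)

/-- Precomposing with units replaces transformations out of `x_*` and `r_*` by transformations out
of the identity. By `unit_comp_mate`, factoring through the mate then becomes lifting along the
transposed counit. -/
lemma isPointwise_of_lifts (t : RightExtension f x)
    (h : ∀ (G : F ⥤ X), Lifts (transposeCounit t) (𝟭 X) G) : IsPointwise t := by
  intro G _ β
  let κ := transposeCounit t
  have key (α : GeomMor.direct t.extension ⟶ G) (A : X) :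
      (GeomMor.adj x).unit.app A ≫
        (mate t ≫ Functor.whiskerLeft (GeomMor.direct f) α).app ((GeomMor.inverse x).obj A) =
      ((GeomMor.adj t.extension).unit.app A ≫ α.app ((GeomMor.inverse t.extension).obj A)) ≫
        G.map (κ.app A) := by
    refine (Category.assoc _ _ _).symm.trans ?_
    rw [unit_comp_mate, Category.assoc, Category.assoc, ← α.naturality]
    rfl
  let δ' : 𝟭 X ⟶ (GeomMor.inverse x ⋙ GeomMor.direct f) ⋙ G :=
    (GeomMor.adj x).unit ≫ Functor.whiskerLeft (GeomMor.inverse x) β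
  obtain ⟨δ, hδ, hu⟩ := h G δ'
  obtain ⟨α, hα⟩ := unit_exists (GeomMor.adj t.extension) δ
  refine ⟨α, unit_ext (GeomMor.adj x) fun A => ?_, fun α' h' => ?_⟩
  · refine (key α A).trans ?_
    rw [hα]
    exact NatTrans.congr_app hδ A
  · refine unit_ext (GeomMor.adj t.extension) fun A => ?_
    rw [hα]
    let δ'' : 𝟭 X ⟶ GeomMor.inverse t.extension ⋙ G :=
      (GeomMor.adj t.extension).unit ≫ Functor.whiskerLeft (GeomMor.inverse t.extension) α'
    have : δ'' = δ := hu _ (by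
      ext A
      refine (key α' A).symm.trans ?_
      rw [h']
      rfl)
    exact NatTrans.congr_app this A

end Extensions

/-! ### Coadjoint retracts are weakly right Kan injective -/

section Retract

variable {X Z : Topos.{u}}

/-- An adjunction of geometric morphisms gives an adjunction of their inverse images. -/
def inverseAdjunction {r : Z ⟶ X} {s : X ⟶ Z} (h : Bicategory.Adjunction s r) :
    CategoryTheory.Adjunction (GeomMor.inverse r) (GeomMor.inverse s) :=
  .mkOfUnitCounit
    { unit := GeomMor.nat h.unit
      counit := GeomMor.nat h.counit
      left_triangle := by
        ext A
        have := congrArg (fun α => (GeomMor.nat α).app A) h.right_triangle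
        simp [rightZigzag, bicategoricalComp, BicategoricalCoherence.iso] at this
        exact this.trans (Category.comp_id _)
      right_triangle := by
        ext A
        have := congrArg (fun α => (GeomMor.nat α).app A) h.left_triangle
        simp [leftZigzag, bicategoricalComp, BicategoricalCoherence.iso] at this
        exact this.trans (Category.comp_id _) }

/-- An adjunction of inverse images gives an adjunction of geometric morphisms. -/
def adjunctionOfInverse {r : Z ⟶ X} {s : X ⟶ Z}
    (h : CategoryTheory.Adjunction (GeomMor.inverse r) (GeomMor.inverse s)) :
    Bicategory.Adjunction s r where
  unit := GeomMor.Hom₂.mk h.unit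
  counit := GeomMor.Hom₂.mk h.counit
  left_triangle := by
    ext A
    simp [leftZigzag, bicategoricalComp, BicategoricalCoherence.iso]
    exact (congrArg (_ ≫ ·) (Category.id_comp _)).trans
      ((h.right_triangle_components A).trans (Category.comp_id _).symm)
  right_triangle := by
    ext A
    simp [rightZigzag, bicategoricalComp, BicategoricalCoherence.iso]
    exact (congrArg (_ ≫ ·) (Category.id_comp _)).trans
      ((h.left_triangle_components A).trans (Category.comp_id _).symm)

lemma transposeCounit_iso {E F : Topos.{u}} {f : E ⟶ F} {x : E ⟶ X} {t t' : RightExtension f x}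
    (e : t ≅ t') : GeomMor.nat e.hom.left ≫ transposeCounit t' = transposeCounit t :=
  (comp_transposeCounit_eq_iff t' t e.hom.left).2 (RightExtension.w e.hom)

/-- One lifting property serves twice: with `H = g^*` and `G` the identity it says that `t` is a Kan
extension, with `H` the identity and `G` arbitrary that it is pointwise. -/
lemma wRInjPw_of_isCoadjointRetract (P : CosievePres Z) (h : IsCoadjointRetract X Z) :
    WRInjPw IsDominant X := by
  obtain ⟨r, s, ⟨hadj⟩, ⟨hiso⟩⟩ := h
  let a := inverseAdjunction hadj
  let j : GeomMor.inverse r ⋙ GeomMor.inverse s ≅ 𝟭 X :=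
    ⟨GeomMor.nat hiso.hom, GeomMor.nat hiso.inv, congrArg GeomMor.nat hiso.hom_inv_id,
      congrArg GeomMor.nat hiso.inv_hom_id⟩
  have : IsIso a.unit := a.isIso_unit_of_iso j
  have key {E F : Topos.{u}} (f : E ⟶ F) (hf : IsDominant f) (x : E ⟶ X) :
      ∃ t : RightExtension f x, Nonempty t.IsKan ∧
        ∀ G : F ⥤ X, Lifts (transposeCounit t) (𝟭 X) G := by
    have hf' : PreservesColimitsOfShape (Discrete PEmpty.{1}) (GeomMor.direct f) := hf
    let Q := GeomMor.inverse x ⋙ GeomMor.direct f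
    have : PreservesFiniteLimits (GeomMor.inverse x) := GeomMor.lex x
    have : PreservesFiniteLimits (GeomMor.inverse s) := GeomMor.lex s
    let M : P.C ⥤ F := P.incl ⋙ GeomMor.inverse s ⋙ Q
    have : PreservesFiniteLimits M := inferInstance
    -- Inverse images preserve initial objects, and `f_*` does by dominance.
    have hM (c : P.C) (hc : ¬ P.D c) : Nonempty (IsInitial (M.obj c)) := by
      obtain ⟨hi⟩ := P.initial c hc
      exact ⟨((GeomMor.adj x).isInitialObj ((GeomMor.adj s).isInitialObj hi)).isInitialObj
        (GeomMor.direct f)⟩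
    obtain ⟨T, ⟨e⟩⟩ := P.lift F M hM
    obtain ⟨κ, hκ⟩ := leftAdjoint_exists (v := P.D.ι ⋙ P.incl)
      (H := GeomMor.inverse s ⋙ Q) (GeomMor.adj T) e.hom
    have hκ' (d) : IsIso (κ.app ((P.D.ι ⋙ P.incl).obj d)) := by
      rw [hκ]
      infer_instance
    let t : RightExtension f x := extensionMk (T ≫ r) (restrictLift a κ)
    have ht {Y : Topos.{u}} (H : X ⥤ Y) (R : Y ⥤ X) (adj : CategoryTheory.Adjunction H R)
        (G : F ⥤ Y) : Lifts (transposeCounit t) H G := by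
      have := lifts_restrictLift a κ
        (lifts_of_dense κ hκ' ((GeomMor.adj s).comp adj) G)
      rwa [← transposeCounit_extensionMk (T ≫ r) (restrictLift a κ)] at this
    exact ⟨t, isKan_of_lifts t fun g => ht _ _ (GeomMor.adj g) _, ht _ _ Adjunction.id⟩
  refine ⟨fun E F f hf x => ?_, fun E F f hf x t' ⟨ht'⟩ => isPointwise_of_lifts t' fun G => ?_⟩
  · obtain ⟨t, ht, -⟩ := key f hf x
    exact ⟨t, ht⟩
  -- An arbitrary Kan extension `t'` is isomorphic to the constructed one, and lifting transfers
  -- along the isomorphism.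
  · obtain ⟨t, ⟨ht⟩, hl⟩ := key f hf x
    let e : t ≅ t' := ht.uniqueUpToIso ht'
    let e' : GeomMor.inverse t.extension ≅ GeomMor.inverse t'.extension :=
      ⟨GeomMor.nat e.hom.left, GeomMor.nat e.inv.left,
        congrArg (fun α => GeomMor.nat α.left) e.hom_inv_id,
        congrArg (fun α => GeomMor.nat α.left) e.inv_hom_id⟩
    refine Lifts.of_iso_comp e' ?_
    have := hl G
    rwa [← transposeCounit_iso e] at this

end Retract

/-! ### Weakly right Kan injective topoi are coadjoint retracts -/

section Generators

/-- The nerve of a left adjoint restricted to representables is the right adjoint. -/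
noncomputable def nerveOfAdjunction {C : Type u} [SmallCategory C] {X : Type*} [Category.{u} X]
    {L : (Cᵒᵖ ⥤ Type u) ⥤ X} {R : X ⥤ Cᵒᵖ ⥤ Type u} (adj : L ⊣ R) :
    restrictedULiftYoneda.{u} (uliftYoneda.{u} ⋙ L) ≅ R :=
  NatIso.ofComponents (fun A => NatIso.ofComponents
    (fun c => (Equiv.ulift.trans ((adj.homEquiv _ _).trans uliftYonedaEquiv)).toIso) (fun f => by
      ext x
      change uliftYonedaEquiv (adj.homEquiv _ _ (L.map (uliftYoneda.map f.unop) ≫ x.down)) =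
        (R.obj A).map f (uliftYonedaEquiv (adj.homEquiv _ _ x.down))
      rw [adj.homEquiv_naturality_left, uliftYonedaEquiv_naturality])) (fun f => by
    ext c x
    change uliftYonedaEquiv (adj.homEquiv _ _ (x.down ≫ f)) =
      (R.map f).app c (uliftYonedaEquiv (adj.homEquiv _ _ x.down))
    rw [adj.homEquiv_naturality_right]
    rfl)

/-- For sheafified representables the nerve is the inclusion of sheaves into presheaves, up to
isomorphism. -/
lemma exists_dense_nerve (X : Topos.{u}) : ∃ (C : Type u) (_ : SmallCategory C) (w : C ⥤ X),
    (restrictedULiftYoneda.{u} w).Full ∧ (restrictedULiftYoneda.{u} w).Faithful := by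
  obtain ⟨C, _, J, ⟨e⟩⟩ := X.isGrothendieck
  let i := nerveOfAdjunction ((sheafificationAdjunction J (Type u)).comp e.symm.toAdjunction)
  exact ⟨C, _, _, Functor.Full.of_iso i.symm, Functor.Faithful.of_iso i.symm⟩

/-- Enlarging a dense family of objects, and removing initial objects, preserves density. -/
lemma isDense_of_nerve {X : Topos.{u}} {C₀ : Type u} [SmallCategory C₀] (w₀ : C₀ ⥤ X)
    [(restrictedULiftYoneda.{u} w₀).Full] [(restrictedULiftYoneda.{u} w₀).Faithful]
    {A : Type u} [SmallCategory A] (w : A ⥤ X) [w.Full]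
    (h : ∀ c, Nonempty (IsInitial (w₀.obj c)) ∨ ∃ a, Nonempty (w.obj a ≅ w₀.obj c)) :
    w.IsDense := by
  have hext {B B' : X} {f g : B ⟶ B'} (hfg : ∀ (c : C₀) (k : w₀.obj c ⟶ B), k ≫ f = k ≫ g) :
      f = g := by
    apply (restrictedULiftYoneda.{u} w₀).map_injective
    ext c k
    exact congrArg ULift.up (hfg c.unop k.down)
  have hfaith : (restrictedULiftYoneda.{u} w).Faithful := ⟨fun {B B'} f g hfg => hext fun c k => by
    obtain ⟨⟨hi⟩⟩ | ⟨a, ⟨e⟩⟩ := h c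
    · exact hi.hom_ext _ _
    · have : ULift.up ((e.hom ≫ k) ≫ f) = ULift.up ((e.hom ≫ k) ≫ g) :=
        ConcreteCategory.congr_hom (NatTrans.congr_app hfg (op a))
          (ULift.up (e.hom ≫ k) : ULift.{u} (w.obj a ⟶ B))
      have := ULift.up_injective this
      rwa [Category.assoc, Category.assoc, cancel_epi] at this⟩
  have hfull : (restrictedULiftYoneda.{u} w).Full := by
    refine ⟨fun {B B'} φ => ?_⟩
    have hφ {a b : A} (m : w.obj a ⟶ w.obj b) (k : w.obj b ⟶ B) :
        (φ.app (op a) (ULift.up (m ≫ k))).down = m ≫ (φ.app (op b) (ULift.up k)).down := by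
      obtain ⟨m, rfl⟩ := w.map_surjective m
      exact congrArg ULift.down (ConcreteCategory.congr_hom (φ.naturality m.op)
        (ULift.up k : ULift.{u} (w.obj b ⟶ B)))
    have hψ (c : C₀) (k : w₀.obj c ⟶ B) : ∃ k' : w₀.obj c ⟶ B', ∀ (a : A)
        (m : w.obj a ⟶ w₀.obj c), (φ.app (op a) (ULift.up (m ≫ k))).down = m ≫ k' := by
      obtain ⟨⟨hi⟩⟩ | ⟨b, ⟨e⟩⟩ := h c
      · exact ⟨hi.to _, fun a m => (IsInitial.ofStrict m hi).hom_ext _ _⟩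
      · refine ⟨e.inv ≫ (φ.app (op b) (ULift.up (e.hom ≫ k))).down, fun a m => ?_⟩
        rw [← Category.assoc, ← hφ]
        simp
    have hext' {c : C₀} {Y : X} {f g : w₀.obj c ⟶ Y}
        (hfg : ∀ (a : A) (m : w.obj a ⟶ w₀.obj c), m ≫ f = m ≫ g) : f = g := by
      obtain ⟨⟨hi⟩⟩ | ⟨b, ⟨e⟩⟩ := h c
      · exact hi.hom_ext _ _
      · rw [← cancel_epi e.hom]
        exact hfg b e.hom
    choose ψ hψ using hψ
    -- A map of `w`-nerves extends to one of `w₀`-nerves, since the generators missing from `w` are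
    -- initial and carry no data. Fullness for `w₀` then provides the arrow.
    let Ψ : (restrictedULiftYoneda.{u} w₀).obj B ⟶ (restrictedULiftYoneda.{u} w₀).obj B' :=
      { app c := ↾fun k => ULift.up (ψ c.unop k.down)
        naturality c d m := by
          ext k
          refine congrArg ULift.up (hext' fun a n => ?_)
          refine (hψ _ _ a n).symm.trans ?_
          refine Eq.trans ?_ (Category.assoc _ _ _)
          refine Eq.trans ?_ (hψ _ _ a (n ≫ w₀.map m.unop))
          rw [Category.assoc]
          rfl }
    obtain ⟨f, hf⟩ := (restrictedULiftYoneda.{u} w₀).map_surjective Ψ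
    have hf' (c : C₀) (k : w₀.obj c ⟶ B) : k ≫ f = ψ c k :=
      congrArg ULift.down (ConcreteCategory.congr_hom (NatTrans.congr_app hf (op c))
        (ULift.up k : ULift.{u} (w₀.obj c ⟶ B)))
    refine ⟨f, ?_⟩
    ext a k
    refine ULift.ext _ _ ?_
    change k.down ≫ f = (φ.app a k).down
    refine hext fun c n => hext' fun b m => ?_
    rw [← Category.assoc n, hf', ← hψ, ← Category.assoc m n, hφ, Category.assoc]
    rfl
  exact Functor.IsDense.of_fullyFaithful_restrictedULiftYoneda (.ofFullyFaithful _)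

/-- A left adjoint of a fully faithful functor is its left Kan extension, in a suitable dense
situation. -/
lemma existsUnique_counit {A X Z : Type*} [Category* A] [Category* X] [Category* Z] {L : Z ⥤ X}
    {R : X ⥤ Z} (adj : L ⊣ R) [IsIso adj.counit] (w : A ⥤ X) [w.IsDense] [(w ⋙ R).IsDense]
    {G : Z ⥤ X} (γ : 𝟭 X ⟶ R ⋙ G) :
    ∃! α : L ⟶ G, Functor.whiskerLeft R α = adj.counit ≫ γ := by
  obtain ⟨α, hα⟩ := leftAdjoint_exists (v := w ⋙ R) adj (H := G)
    (Functor.whiskerLeft w (adj.counit ≫ γ))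
  refine ⟨α, ?_, fun α' h' => leftAdjoint_ext (v := w ⋙ R) adj fun a => ?_⟩
  · have : inv adj.counit ≫ Functor.whiskerLeft R α = γ := dense_ext (v := w) fun a => by
      have h1 : α.app (R.obj (w.obj a)) = (adj.counit ≫ γ).app (w.obj a) := hα a
      have h2 : inv adj.counit ≫ adj.counit ≫ γ = γ := IsIso.inv_hom_id_assoc _ _
      refine (congrArg ((inv adj.counit).app (w.obj a) ≫ ·) h1).trans ?_
      exact NatTrans.congr_app h2 (w.obj a)
    rw [← this, IsIso.hom_inv_id_assoc]
  · rw [hα]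
    exact NatTrans.congr_app h' (w.obj a)

/-- The functors `p_*` and `i^*` are left Kan extensions of the identity along `i_*`, the first by
pointwiseness, the second by density. Both are left exact, so they can be compared, and `p^* ⊣ p_* ≅
i^*` is the required adjunction. -/
lemma exists_isCoadjointRetract {X : Topos.{u}} (hX : WRInjPw IsDominant X) :
    ∃ Z : Topos.{u}, IsPshOfCosieve Z ∧ IsCoadjointRetract X Z := by
  obtain ⟨C₀, _, w₀, _, _⟩ := exists_dense_nerve X
  obtain ⟨C, _, _, ι, _, _, _, hobj, -⟩ := exists_lexHull w₀.obj
  let D := noninitial ι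
  let w : D.FullSubcategory ⥤ X := D.ι ⋙ ι
  have hw : w.IsDense := isDense_of_nerve w₀ w fun c => by
    obtain ⟨d, ⟨e⟩⟩ := hobj c
    by_cases hd : D d
    · exact Or.inr ⟨⟨d, hd⟩, ⟨e⟩⟩
    · obtain ⟨hi⟩ := isInitial_of_not_noninitial ι d hd
      exact Or.inl ⟨hi.ofIso e⟩
  let Z := pshTopos D.FullSubcategory
  let i : X ⟶ Z := hullMor ι
  have hfull : (GeomMor.direct i).Full := inferInstanceAs (restrictedULiftYoneda.{u} w).Full
  have hfaith : (GeomMor.direct i).Faithful :=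
    inferInstanceAs (restrictedULiftYoneda.{u} w).Faithful
  have hcounit : IsIso (GeomMor.adj i).counit := inferInstance
  have hwi : (w ⋙ GeomMor.direct i).IsDense := Functor.IsDense.of_iso (yonedaNerveIso w)
  obtain ⟨t, ⟨ht⟩⟩ := hX.1 i (isDominant_hullMor ι) (𝟙 X)
  have hpw := hX.2 i (isDominant_hullMor ι) (𝟙 X) t ⟨ht⟩
  let p : Z ⟶ X := t.extension
  let μ : 𝟭 X ⟶ GeomMor.direct i ⋙ GeomMor.direct p := mate t
  have hμ (G : Z ⥤ X) [PreservesFiniteLimits G] (β : 𝟭 X ⟶ GeomMor.direct i ⋙ G) :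
      ∃! α : GeomMor.direct p ⟶ G, μ ≫ Functor.whiskerLeft (GeomMor.direct i) α = β := hpw G β
  have : PreservesFiniteLimits (GeomMor.inverse i) := GeomMor.lex i
  have : PreservesFiniteLimits (GeomMor.direct p) := preservesFiniteLimits_direct p
  obtain ⟨a, ha, -⟩ := hμ (GeomMor.inverse i) (inv (GeomMor.adj i).counit)
  obtain ⟨b, hb, -⟩ := existsUnique_counit (GeomMor.adj i) w μ
  let e : GeomMor.direct p ≅ GeomMor.inverse i :=
    { hom := a
      inv := b
      hom_inv_id := (hμ _ μ).unique
        (by rw [Functor.whiskerLeft_comp, reassoc_of% ha, hb, IsIso.inv_hom_id_assoc]) (by simp)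
      inv_hom_id := (existsUnique_counit (GeomMor.adj i) w (inv (GeomMor.adj i).counit)).unique
        (by rw [Functor.whiskerLeft_comp, hb, Category.assoc, ha]) (by simp) }
  have adj : CategoryTheory.Adjunction (GeomMor.inverse p) (GeomMor.inverse i) :=
    (GeomMor.adj p).ofNatIsoRight e
  -- The direct image of `i ≫ p` is `i_* ⋙ p_* ≅ i_* ⋙ i^* ≅ 𝟭 X`; taking left adjoints gives the
  -- statement for inverse images.
  let j : GeomMor.inverse p ⋙ GeomMor.inverse i ≅ 𝟭 X :=
    (conjugateIsoEquiv Adjunction.id ((GeomMor.adj p).comp (GeomMor.adj i))).symm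
      ((asIso (GeomMor.adj i).counit).symm ≪≫
        Functor.isoWhiskerLeft (GeomMor.direct i) e.symm)
  exact ⟨Z, ⟨C, _, inferInstance, D, isCosieve_noninitial ι, ⟨CategoryTheory.Equivalence.refl⟩⟩,
    p, i, ⟨adjunctionOfInverse adj⟩, ⟨GeomMor.isoMk (f := i ≫ p) (g := 𝟙 X) j⟩⟩

end Generators

end KanInj

theorem mainTheorem8 :
    (∀ X : KanInj.Topos.{u},
      KanInj.WRInjPw KanInj.IsDominant X ↔
        ∃ (S : KanInj.Signature.{u}) (T : KanInj.Theory S) (Z : KanInj.Topos.{u}),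
          KanInj.IsEssAlgWithFalsum T ∧ KanInj.IsClassifying T Z ∧
            KanInj.IsCoadjointRetract X Z) ∧
    (∀ Z : KanInj.Topos.{u},
      (∃ (S : KanInj.Signature.{u}) (T : KanInj.Theory S),
          KanInj.IsEssAlgWithFalsum T ∧ KanInj.IsClassifying T Z) ↔
        KanInj.IsPshOfCosieve Z) ∧
    (∀ Z : KanInj.Topos.{u},
      KanInj.IsPshOfCosieve Z ↔ KanInj.IsClosedSubtoposOfFree Z) := by
  refine ⟨fun X => ⟨fun hX => ?_, ?_⟩, fun Z => ⟨?_, ?_⟩, fun Z => ⟨?_, ?_⟩⟩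
  · obtain ⟨Z, hZ, hr⟩ := KanInj.exists_isCoadjointRetract hX
    obtain ⟨S, T, hT, hc⟩ := KanInj.exists_isClassifying_of_isPshOfCosieve hZ
    exact ⟨S, T, Z, hT, hc, hr⟩
  · rintro ⟨S, T, Z, hT, hc, hr⟩
    obtain ⟨P⟩ := KanInj.nonempty_cosievePres (KanInj.isPshOfCosieve_of_isClassifying hT hc)
    exact KanInj.wRInjPw_of_isCoadjointRetract P hr
  · rintro ⟨S, T, hT, hc⟩
    exact KanInj.isPshOfCosieve_of_isClassifying hT hc
  · exact KanInj.exists_isClassifying_of_isPshOfCosieve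
  · exact KanInj.isClosedSubtoposOfFree_of_isPshOfCosieve
  · exact KanInj.isPshOfCosieve_of_isClosedSubtoposOfFree
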